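/- Let $n\ge 1$ and let $\Omega\subset\mathbb R^n$ be a bounded domain (open, connected, non-empty) with $C^2$ boundary. Let $p:\Omega\to\mathbb R$ be continuous with $p_-:=\inf_\Omega p>n$; $p$ may be unbounded, i.e. $p_+:=\sup_\Omega p=\infty$ is allowed. For measurable $f$ on $\Omega$ put $\rho_p(f)=\int_\Omega \frac{|f(x)|^{p(x)}}{p(x)}\,dx\in[0,\infty]$, and for a function $u$ with distributional gradient $\nabla u$ put $\rho_{1,p}(u)=\rho_p(u)+\rho_p(|\nabla u|)$. Let $W^{1,p}(\Omega)$ be the set of those $u$ (modulo null sets) for which $\rho_{1,p}(\lambda u)<\infty$ for some $\lambda>0$. A set $A\subseteq W^{1,p}(\Omega)$ is called $\rho_{1,p}$-closed if $u\in A$ whenever $u\in W^{1,p}(\Omega)$, $(u_k)\subseteq A$ and $\rho_{1,p}(u_k-u)\to 0$; let $V^{1,p}_0(\Omega)$ be the intersection of all $\rho_{1,p}$-closed sets that contain $C_0^\infty(\Omega)$. Let $\varphi\in W^{1,p}(\Omega)$ satisfy $\int_\Omega\frac{|\nabla\varphi|^{p}}{p}\,dx<\infty$. Then the Dirichlet problem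 $$\Delta_p u=\operatorname{div}\left(|\nabla u|^{p(x)-2}\nabla u\right)=0\ \text{ in }\Omega,\qquad u|_{\partial\Omega}=\varphi$$ has a solution $u\in W^{1,p}(\Omega)$, in the sense that $|\nabla u|^{p-2}\nabla u$ is locally integrable in $\Omega$, $\int_\Omega|\nabla u|^{p-2}\nabla u\cdot\nabla h\,dx=0$ for all $h\in C_0^\infty(\Omega)$, and $u-\varphi\in V^{1,p}_0(\Omega)$. Moreover $u$ can be taken of the form $u=\varphi-v$, where $v\in V^{1,p}_0(\Omega)$ minimizes $w\mapsto\int_\Omega\frac{|\nabla(w-\varphi)|^{p}}{p}\,dx$ over $V^{1,p}_0(\Omega)$, and the minimum is finite. -/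

import Mathlib

open MeasureTheory Filter Topology
open scoped ENNReal ContDiff

/-! Modular topology on a real vector space: the modular space, modularly closed sets and the
modular closure of a set. -/

namespace Modular

variable {X : Type*} [AddCommGroup X] [Module ℝ X]

/-- The modular space `X_ρ`, the set of all `x` with `ρ (c x) < ∞` for some `c > 0`. -/
def space (ρ : X → ℝ≥0∞) : Set X :=
  {x | ∃ c : ℝ, 0 < c ∧ ρ (c • x) < ⊤}

/-- `A ⊆ X_ρ` is `ρ`-closed if it contains every `a ∈ X_ρ` that is the `ρ`-limit of a sequence
in `A`, where `x k` `ρ`-converges to `a` when `ρ (x k - a) → 0`. -/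
def IsClosed (ρ : X → ℝ≥0∞) (A : Set X) : Prop :=
  A ⊆ space ρ ∧
    ∀ (x : ℕ → X) (a : X), a ∈ space ρ → (∀ k, x k ∈ A) →
      Tendsto (fun k => ρ (x k - a)) atTop (𝓝 0) → a ∈ A

/-- The `ρ`-closure of `A ⊆ X_ρ`: the intersection of all `ρ`-closed subsets of `X_ρ`
that contain `A`. -/
def closure (ρ : X → ℝ≥0∞) (A : Set X) : Set X :=
  ⋂₀ {B | IsClosed ρ B ∧ A ⊆ B}

end Modular

/-! Variable exponent Sobolev spaces. Functions on `Ω` are represented by functions on the whole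
space, of which only the restriction to `Ω`, up to null sets, matters. -/

namespace VarExp

variable {n : ℕ}

/-- The boundary of `Ω` is locally the graph of a `C²` function: near each boundary point,
for a unit vector `ν` and a `C²` function `ψ` on the hyperplane orthogonal to `ν`, the set `Ω`
is the set of points that lie above the graph of `ψ` in the direction `ν`. -/
def HasC2Boundary (Ω : Set (EuclideanSpace ℝ (Fin n))) : Prop :=
  ∀ P ∈ frontier Ω, ∃ ν : EuclideanSpace ℝ (Fin n), ‖ν‖ = 1 ∧
    ∃ ψ : (Submodule.span ℝ {ν})ᗮ → ℝ, ContDiff ℝ 2 ψ ∧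
      ∃ U ∈ 𝓝 P, ∀ x ∈ U,
        (x ∈ Ω ↔ ψ ((Submodule.span ℝ {ν})ᗮ.orthogonalProjectionOnto x) < inner ℝ ν x)

/-- `C₀^∞(Ω)`: smooth functions with compact support contained in `Ω`. -/
def testFunctions (Ω : Set (EuclideanSpace ℝ (Fin n))) : Set (EuclideanSpace ℝ (Fin n) → ℝ) :=
  {η | ContDiff ℝ ∞ η ∧ HasCompactSupport η ∧ tsupport η ⊆ Ω}

/-- `G` is a distributional gradient of `u` on `Ω`. -/
def HasWeakGradient (Ω : Set (EuclideanSpace ℝ (Fin n))) (u : EuclideanSpace ℝ (Fin n) → ℝ)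
    (G : EuclideanSpace ℝ (Fin n) → EuclideanSpace ℝ (Fin n)) : Prop :=
  LocallyIntegrableOn u Ω ∧ LocallyIntegrableOn G Ω ∧
    ∀ η ∈ testFunctions Ω, ∀ e : EuclideanSpace ℝ (Fin n),
      ∫ x in Ω, u x * fderiv ℝ η x e = -∫ x in Ω, inner ℝ (G x) e * η x

open Classical in
/-- The distributional gradient `∇u` of `u` on `Ω` (unique up to null sets; `0` if `u` has
no locally integrable distributional gradient). -/
noncomputable def weakGradient (Ω : Set (EuclideanSpace ℝ (Fin n)))
    (u : EuclideanSpace ℝ (Fin n) → ℝ) : EuclideanSpace ℝ (Fin n) → EuclideanSpace ℝ (Fin n) :=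
  if h : ∃ G, HasWeakGradient Ω u G then h.choose else 0

/-- `ρ_p(f) = ∫_Ω |f|^p / p dx`, with value in `[0, ∞]`. -/
noncomputable def modular (Ω : Set (EuclideanSpace ℝ (Fin n))) (p : EuclideanSpace ℝ (Fin n) → ℝ)
    (f : EuclideanSpace ℝ (Fin n) → ℝ) : ℝ≥0∞ :=
  ∫⁻ x in Ω, ENNReal.ofReal (|f x| ^ p x / p x)

/-- `ρ_p(|∇u|) = ∫_Ω |∇u|^p / p dx`. -/
noncomputable def gradientModular (Ω : Set (EuclideanSpace ℝ (Fin n)))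
    (p : EuclideanSpace ℝ (Fin n) → ℝ) (u : EuclideanSpace ℝ (Fin n) → ℝ) : ℝ≥0∞ :=
  modular Ω p (fun x => ‖weakGradient Ω u x‖)

open Classical in
/-- `ρ_{1,p}(u) = ρ_p(u) + ρ_p(|∇u|)` on the functions that have a distributional gradient,
and `∞` on all others. -/
noncomputable def sobolevModular (Ω : Set (EuclideanSpace ℝ (Fin n)))
    (p : EuclideanSpace ℝ (Fin n) → ℝ) (u : EuclideanSpace ℝ (Fin n) → ℝ) : ℝ≥0∞ :=
  if ∃ G, HasWeakGradient Ω u G then modular Ω p u + gradientModular Ω p u else ⊤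

/-- `W^{1,p}(Ω)`: the functions `u` that have a distributional gradient and satisfy
`ρ_{1,p}(c u) < ∞` for some `c > 0`. -/
noncomputable def W1 (Ω : Set (EuclideanSpace ℝ (Fin n))) (p : EuclideanSpace ℝ (Fin n) → ℝ) :
    Set (EuclideanSpace ℝ (Fin n) → ℝ) :=
  Modular.space (sobolevModular Ω p)

/-- `V₀^{1,p}(Ω)`: the `ρ_{1,p}`-closure of `C₀^∞(Ω)` in `W^{1,p}(Ω)`. -/
noncomputable def V10 (Ω : Set (EuclideanSpace ℝ (Fin n))) (p : EuclideanSpace ℝ (Fin n) → ℝ) :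
    Set (EuclideanSpace ℝ (Fin n) → ℝ) :=
  Modular.closure (sobolevModular Ω p) (testFunctions Ω)

/-- The vector field `|∇u|^{p-2} ∇u`. -/
noncomputable def flux (Ω : Set (EuclideanSpace ℝ (Fin n))) (p : EuclideanSpace ℝ (Fin n) → ℝ)
    (u : EuclideanSpace ℝ (Fin n) → ℝ) (x : EuclideanSpace ℝ (Fin n)) :
    EuclideanSpace ℝ (Fin n) :=
  ‖weakGradient Ω u x‖ ^ (p x - 2) • weakGradient Ω u x

/-- `u` is a weak solution of `Δ_p u = div (|∇u|^{p-2} ∇u) = 0` in `Ω`. -/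
def IsWeakSolution (Ω : Set (EuclideanSpace ℝ (Fin n))) (p : EuclideanSpace ℝ (Fin n) → ℝ)
    (u : EuclideanSpace ℝ (Fin n) → ℝ) : Prop :=
  (∃ G, HasWeakGradient Ω u G) ∧ LocallyIntegrableOn (flux Ω p u) Ω ∧
    ∀ η ∈ testFunctions Ω, ∫ x in Ω, inner ℝ (flux Ω p u x) (gradient η x) = 0

end VarExp

/-!
Existence for the Dirichlet problem of the `p(x)`-Laplacian with unbounded `p > n`, by the direct
method, where modular uniform convexity replaces weak compactness.

Write `F w = ∫ |∇(w - φ)|^p / p` and let `v k` be a minimizing sequence in `V₀^{1,p}`. The midpoint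
of two members of `V₀^{1,p}` lies in it again (`Modular.add_mem_closure`,
`Modular.smul_mem_closure`), so `F` of the midpoint is at least the infimum. Uniform convexity of
`x ↦ ‖x‖^r`, with constants uniform in `r ≥ q > 1` (`exists_norm_half_sub_rpow_le`), then forces
`∫ |(∇v j - ∇v k) / 2|^p / p → 0` (`tendsto_normModular_half_sub`). The exponent is not bounded, so
the factor `1/2` cannot be removed, and `v k → v` may fail in the modular; but `v k / 2 → v / 2` is
enough, because `V₀^{1,p}` is closed under multiplication by `2`.

Since `p ≥ q > n`, modular convergence gives `L^q` convergence of gradients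
(`tendsto_eLpNorm_of_normModular`), and Morrey's estimate, proved for test functions
(`exists_enorm_le_eLpNorm_gradient`) and inherited by the modular closure
(`exists_eLpNorm_top_le`), turns this into uniform convergence of the functions. On a set of
finite measure uniform convergence implies modular convergence (`normModular_le_eLpNorm_top`), so
both parts of the Sobolev modular are controlled (`exists_mem_V10_of_cauchy`). Fatou's lemma makes
the limit a minimizer (`exists_minimizer`).

For the equation, a test function lives on a compact subset of `Ω`, where the continuous exponent
is bounded. The energy can therefore be differentiated in the direction of a test function
(`integral_inner_rpow_smul_eq_zero`), and the derivative vanishes at the minimizer.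
-/

/-! ### Modular closures of linear subspaces -/

namespace Modular

variable {X : Type*} [AddCommGroup X] [Module ℝ X] {ρ : X → ℝ≥0∞} {A B : Set X}

/-- The two properties of a modular that make its modular space a linear subspace: it decreases
under scalars of absolute value at most one, and it is subadditive up to the factor `1/2` in the
argument. Every even convex modular has them. -/
structure IsQuasiConvex (ρ : X → ℝ≥0∞) : Prop where
  smul_le : ∀ (c : ℝ) (x : X), |c| ≤ 1 → ρ (c • x) ≤ ρ x
  half_add_le : ∀ x y : X, ρ ((1 / 2 : ℝ) • (x + y)) ≤ ρ x + ρ y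

theorem smul_mem_space (hρ : IsQuasiConvex ρ) {x : X} (hx : x ∈ space ρ) (c : ℝ) :
    c • x ∈ space ρ := by
  obtain ⟨d, hd, h⟩ := hx
  refine ⟨d / (|c| + 1), by positivity, lt_of_le_of_lt ?_ h⟩
  have : (d / (|c| + 1)) • c • x = (c / (|c| + 1)) • d • x := by
    simp only [smul_smul]; congr 1; ring
  rw [this]
  refine hρ.smul_le _ _ ?_
  have h1 : (0 : ℝ) < |c| + 1 := by positivity
  rw [abs_div, abs_of_pos h1, div_le_one h1]
  linarith

theorem add_mem_space (hρ : IsQuasiConvex ρ) {x y : X} (hx : x ∈ space ρ) (hy : y ∈ space ρ) :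
    x + y ∈ space ρ := by
  obtain ⟨c, hc, hx⟩ := hx
  obtain ⟨d, hd, hy⟩ := hy
  have hm : 0 < min c d := lt_min hc hd
  refine ⟨1 / 2 * min c d, by positivity, ?_⟩
  rw [mul_smul, smul_add]
  refine (hρ.half_add_le _ _).trans_lt (ENNReal.add_lt_top.2 ⟨?_, ?_⟩)
  · have : min c d • x = (min c d / c) • c • x := by
      rw [smul_smul, div_mul_cancel₀ _ hc.ne']
    rw [this]
    refine (hρ.smul_le _ _ ?_).trans_lt hx
    rw [abs_of_pos (by positivity), div_le_one hc]
    exact min_le_left _ _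
  · have : min c d • y = (min c d / d) • d • y := by
      rw [smul_smul, div_mul_cancel₀ _ hd.ne']
    rw [this]
    refine (hρ.smul_le _ _ ?_).trans_lt hy
    rw [abs_of_pos (by positivity), div_le_one hd]
    exact min_le_right _ _

theorem closure_subset (hB : IsClosed ρ B) (hAB : A ⊆ B) : closure ρ A ⊆ B :=
  Set.sInter_subset_of_mem ⟨hB, hAB⟩

theorem subset_closure : A ⊆ closure ρ A :=
  Set.subset_sInter fun _ hB => hB.2

theorem closure_subset_space (hA : A ⊆ space ρ) : closure ρ A ⊆ space ρ :=
  closure_subset ⟨subset_rfl, fun _ _ ha _ _ => ha⟩ hA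

theorem isClosed_closure (hA : A ⊆ space ρ) : IsClosed ρ (closure ρ A) :=
  ⟨closure_subset_space hA, fun x a ha hx hlim =>
    Set.mem_sInter.2 fun _ hB => hB.1.2 x a ha (fun k => closure_subset hB.1 hB.2 (hx k)) hlim⟩

theorem add_mem_closure (hρ : IsQuasiConvex ρ) (hA : A ⊆ space ρ)
    (hadd : ∀ x ∈ A, ∀ y ∈ A, x + y ∈ A) {x y : X} (hx : x ∈ closure ρ A)
    (hy : y ∈ closure ρ A) : x + y ∈ closure ρ A := by
  have key : ∀ z ∈ closure ρ A, IsClosed ρ {w | w ∈ space ρ ∧ w + z ∈ closure ρ A} := by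
    refine fun z hz => ⟨fun w hw => hw.1, fun w a ha hw hlim => ⟨ha, ?_⟩⟩
    refine (isClosed_closure hA).2 (fun k => w k + z) _
      (add_mem_space hρ ha (closure_subset_space hA hz)) (fun k => (hw k).2) ?_
    simpa only [add_sub_add_right_eq_sub] using hlim
  have step : ∀ z ∈ A, ∀ w ∈ closure ρ A, w + z ∈ closure ρ A := fun z hz w hw =>
    (closure_subset (key z (subset_closure hz))
      (fun a ha => ⟨hA ha, subset_closure (hadd a ha z hz)⟩) hw).2
  exact (closure_subset (key y hy)
    (fun a ha => ⟨hA ha, add_comm y a ▸ step a ha y hy⟩) hx).2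

theorem smul_mem_closure (hρ : IsQuasiConvex ρ) (hA : A ⊆ space ρ)
    (hadd : ∀ x ∈ A, ∀ y ∈ A, x + y ∈ A) (hsmul : ∀ (c : ℝ), ∀ x ∈ A, c • x ∈ A) (c : ℝ) {x : X}
    (hx : x ∈ closure ρ A) : c • x ∈ closure ρ A := by
  have small : ∀ c : ℝ, |c| ≤ 1 → ∀ x ∈ closure ρ A, c • x ∈ closure ρ A := by
    intro c hc x hx
    refine (closure_subset (B := {w | w ∈ space ρ ∧ c • w ∈ closure ρ A})
      ⟨fun w hw => hw.1, fun w a ha hw hlim => ⟨ha, ?_⟩⟩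
      (fun a ha => ⟨hA ha, subset_closure (hsmul c a ha)⟩) hx).2
    refine (isClosed_closure hA).2 (fun k => c • w k) _ (smul_mem_space hρ ha c)
      (fun k => (hw k).2) ?_
    refine tendsto_of_tendsto_of_tendsto_of_le_of_le tendsto_const_nhds hlim
      (fun _ => zero_le) fun k => ?_
    rw [← smul_sub]
    exact hρ.smul_le _ _ hc
  have double : ∀ (k : ℕ) (x : X), x ∈ closure ρ A → (2 ^ k : ℝ) • x ∈ closure ρ A := by
    intro k
    induction k with
    | zero => intro x hx; simpa using hx
    | succ k ih =>
      intro x hx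
      rw [pow_succ, mul_smul, two_smul]
      exact ih _ (add_mem_closure hρ hA hadd hx hx)
  -- The scalar is halved until `small` applies, then the halvings are undone by sums.
  obtain ⟨k, hk⟩ := pow_unbounded_of_one_lt |c| (one_lt_two : (1 : ℝ) < 2)
  have h2 : (0 : ℝ) < 2 ^ k := by positivity
  have := double k _ (small (c / 2 ^ k)
    (by rw [abs_div, abs_of_pos h2, div_le_one h2]; exact hk.le) x hx)
  rwa [smul_smul, mul_div_cancel₀ _ h2.ne'] at this

end Modular

/-! ### Uniform convexity of powers of the norm -/

namespace VarExp

section UniformConvexity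

variable {E : Type*} [NormedAddCommGroup E] [InnerProductSpace ℝ E]

/-- Clarkson's inequality for exponents at least two, in an inner product space. -/
theorem norm_half_sub_rpow_add_le {r : ℝ} (hr : 2 ≤ r) (a b : E) :
    ‖(1 / 2 : ℝ) • (a - b)‖ ^ r + ‖(1 / 2 : ℝ) • (a + b)‖ ^ r ≤ (‖a‖ ^ r + ‖b‖ ^ r) / 2 := by
  have sq : ∀ t : ℝ, 0 ≤ t → t ^ r = (t ^ 2) ^ (r / 2) := fun t ht => by
    rw [← Real.rpow_natCast, ← Real.rpow_mul ht]; congr 1; push_cast; ring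
  have par : ‖(1 / 2 : ℝ) • (a - b)‖ ^ 2 + ‖(1 / 2 : ℝ) • (a + b)‖ ^ 2
      = (1 / 2) * ‖a‖ ^ 2 + (1 / 2) * ‖b‖ ^ 2 := by
    have := parallelogram_law_with_norm ℝ a b
    rw [norm_smul, norm_smul, Real.norm_of_nonneg (by norm_num)]
    nlinarith
  rw [sq _ (norm_nonneg _), sq _ (norm_nonneg _), sq ‖a‖ (norm_nonneg _), sq ‖b‖ (norm_nonneg _)]
  refine (Real.add_rpow_le_rpow_add (by positivity) (by positivity) (by linarith)).trans ?_
  rw [par]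
  have := (convexOn_rpow (p := r / 2) (by linarith)).2 (sq_nonneg ‖a‖) (sq_nonneg ‖b‖)
    one_half_pos.le one_half_pos.le (add_halves 1)
  simp only [smul_eq_mul] at this
  linarith

theorem norm_half_add_rpow_lt {r : ℝ} (hr : 1 < r) {a b : E} (hab : a ≠ b) :
    ‖(1 / 2 : ℝ) • (a + b)‖ ^ r < (‖a‖ ^ r + ‖b‖ ^ r) / 2 := by
  have hle : ‖(1 / 2 : ℝ) • (a + b)‖ ≤ 1 / 2 * ‖a‖ + 1 / 2 * ‖b‖ := by
    rw [norm_smul, Real.norm_of_nonneg (by norm_num)]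
    linarith [norm_add_le a b]
  by_cases h : ‖a‖ = ‖b‖
  · have : ‖(1 / 2 : ℝ) • (a + b)‖ < ‖b‖ := by
      have := (norm_add_lt_of_not_sameRay (x := a) (y := b)
        fun hs => hab ((sameRay_iff_of_norm_eq h).1 hs))
      rw [norm_smul, Real.norm_of_nonneg (by norm_num)]
      linarith
    rw [h]
    have := Real.rpow_lt_rpow (norm_nonneg _) this (by linarith : 0 < r)
    linarith
  · have := (strictConvexOn_rpow hr).2 (norm_nonneg a) (norm_nonneg b) h
      one_half_pos one_half_pos (add_halves 1)
    simp only [smul_eq_mul] at this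
    have := Real.rpow_le_rpow (norm_nonneg _) hle (by linarith : 0 ≤ r)
    linarith

/-- Uniform convexity of `v ↦ ‖v‖ ^ r` with a constant that is the same for all `r ≥ q > 1`.
For `r ≥ 2` this is Clarkson's inequality; for `r ∈ [q, 2]` it follows from strict convexity by
homogeneity and compactness. -/
theorem exists_norm_half_sub_rpow_le [FiniteDimensional ℝ E] {q ε : ℝ} (hq : 1 < q)
    (hε : 0 < ε) :
    ∃ C : ℝ, 0 < C ∧ ∀ r : ℝ, q ≤ r → ∀ a b : E,
      ‖(1 / 2 : ℝ) • (a - b)‖ ^ r + C * ‖(1 / 2 : ℝ) • (a + b)‖ ^ r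
        ≤ (ε + C / 2) * (‖a‖ ^ r + ‖b‖ ^ r) := by
  let D : ℝ × E × E → ℝ := fun z =>
    (‖z.2.1‖ ^ z.1 + ‖z.2.2‖ ^ z.1) / 2 - ‖(1 / 2 : ℝ) • (z.2.1 + z.2.2)‖ ^ z.1
  let N : ℝ × E × E → ℝ := fun z => ‖(1 / 2 : ℝ) • (z.2.1 - z.2.2)‖ ^ z.1
  let S : ℝ × E × E → ℝ := fun z => ‖z.2.1‖ ^ z.1 + ‖z.2.2‖ ^ z.1
  let K₀ : Set (ℝ × E × E) := Set.Icc q 2 ×ˢ Metric.sphere (0 : E × E) 1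
  have hK₀ : IsCompact K₀ := isCompact_Icc.prod (isCompact_sphere _ _)
  have cont : ∀ g : ℝ × E × E → E, Continuous g → ContinuousOn (fun z => ‖g z‖ ^ z.1) K₀ := by
    intro g hg z hz
    refine (ContinuousAt.rpow (by fun_prop) (by fun_prop) (Or.inr ?_)).continuousWithinAt
    linarith [hz.1.1]
  have hN : ContinuousOn N K₀ := cont _ (by fun_prop)
  have hS : ContinuousOn S K₀ := (cont _ (by fun_prop)).add (cont _ (by fun_prop))
  have hD : ContinuousOn D K₀ := (hS.div_const 2).sub (cont _ (by fun_prop))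
  let K : Set (ℝ × E × E) := {z | z ∈ K₀ ∧ ε * S z ≤ N z}
  have hK : IsCompact K := by
    refine hK₀.of_isClosed_subset ?_ fun z hz => hz.1
    exact hK₀.isClosed.isClosed_le (continuousOn_const.mul hS) hN
  have hDpos : ∀ z ∈ K, 0 < D z := by
    rintro ⟨r, a, b⟩ ⟨hz, hzε⟩
    have hr : 1 < r := hq.trans_le hz.1.1
    refine sub_pos.2 (norm_half_add_rpow_lt hr ?_)
    intro (hab : a = b)
    subst hab
    have ha : ‖a‖ = 1 := by simpa [Prod.norm_def] using hz.2
    simp [S, N, ha, Real.zero_rpow (by linarith : r ≠ 0)] at hzε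
    linarith
  obtain ⟨δ, hδ, hδK⟩ : ∃ δ : ℝ, 0 < δ ∧ ∀ z ∈ K, δ ≤ D z := by
    rcases K.eq_empty_or_nonempty with h | h
    · exact ⟨1, one_pos, by simp [h]⟩
    · obtain ⟨z, hz, hmin⟩ := hK.exists_isMinOn h (hD.mono fun z hz => hz.1)
      exact ⟨D z, hDpos z hz, fun w hw => hmin hw⟩
  have hconv : ∀ r : ℝ, 1 < r → ∀ a b : E,
      ‖(1 / 2 : ℝ) • (a + b)‖ ^ r ≤ (‖a‖ ^ r + ‖b‖ ^ r) / 2 := by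
    intro r hr a b
    rcases eq_or_ne a b with rfl | h
    · rw [← two_smul ℝ a, smul_smul]; norm_num
    · exact (norm_half_add_rpow_lt hr h).le
  refine ⟨max 1 (1 / δ), by positivity, fun r hr a b => ?_⟩
  have hr1 : 1 < r := hq.trans_le hr
  have hS0 : 0 ≤ ‖a‖ ^ r + ‖b‖ ^ r := by positivity
  suffices h : ‖(1 / 2 : ℝ) • (a - b)‖ ^ r ≤ ε * (‖a‖ ^ r + ‖b‖ ^ r) +
      max 1 (1 / δ) * ((‖a‖ ^ r + ‖b‖ ^ r) / 2 - ‖(1 / 2 : ℝ) • (a + b)‖ ^ r) by linarith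
  have hd0 := sub_nonneg.2 (hconv r hr1 a b)
  rcases le_total 2 r with h2 | h2
  · have := norm_half_sub_rpow_add_le h2 a b
    have h3 := mul_le_mul_of_nonneg_right (le_max_left 1 (1 / δ)) hd0
    have h4 := mul_nonneg hε.le hS0
    linarith
  · -- Both sides are homogeneous of degree `r`, so the pair may be scaled to the unit sphere.
    set s : ℝ := ‖(a, b)‖ with hs
    rcases eq_or_ne (a, b) 0 with h0 | h0
    · obtain ⟨rfl, rfl⟩ := Prod.mk_eq_zero.1 h0
      simp [Real.zero_rpow (by linarith : r ≠ 0)]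
    have hs0 : 0 < s := norm_pos_iff.2 h0
    have hscale : ∀ v : E, ‖v‖ ^ r = s ^ r * ‖s⁻¹ • v‖ ^ r := fun v => by
      rw [← Real.mul_rpow hs0.le (norm_nonneg _), norm_smul, norm_inv, Real.norm_of_nonneg hs0.le,
        mul_inv_cancel_left₀ hs0.ne']
    have hz : (r, s⁻¹ • a, s⁻¹ • b) ∈ K₀ := by
      refine ⟨⟨hr, h2⟩, ?_⟩
      have : ((s⁻¹ • a, s⁻¹ • b) : E × E) = s⁻¹ • (a, b) := rfl
      simp only [mem_sphere_zero_iff_norm]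
      rw [this, norm_smul, norm_inv, Real.norm_of_nonneg hs0.le, inv_mul_cancel₀ hs0.ne']
    have main : N (r, s⁻¹ • a, s⁻¹ • b) ≤ ε * S (r, s⁻¹ • a, s⁻¹ • b) +
        max 1 (1 / δ) * D (r, s⁻¹ • a, s⁻¹ • b) := by
      set z := (r, s⁻¹ • a, s⁻¹ • b)
      have hDz : 0 ≤ D z := sub_nonneg.2 (hconv r hr1 _ _)
      have hSz : 0 ≤ S z := by positivity
      by_cases hzK : z ∈ K
      · have hN1 : N z ≤ 1 := by
          refine Real.rpow_le_one (norm_nonneg _) ?_ (by linarith)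
          have h1 : ‖s⁻¹ • a‖ ≤ 1 := (norm_fst_le (s⁻¹ • a, s⁻¹ • b)).trans_eq
            (mem_sphere_zero_iff_norm.1 hz.2)
          have h2 : ‖s⁻¹ • b‖ ≤ 1 := (norm_snd_le (s⁻¹ • a, s⁻¹ • b)).trans_eq
            (mem_sphere_zero_iff_norm.1 hz.2)
          rw [norm_smul, Real.norm_of_nonneg (by norm_num)]
          linarith [norm_sub_le (s⁻¹ • a) (s⁻¹ • b)]
        have h3 : 1 ≤ max 1 (1 / δ) * D z :=
          calc (1 : ℝ) = 1 / δ * δ := by field_simp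
            _ ≤ max 1 (1 / δ) * D z := by gcongr; exacts [le_max_right _ _, hδK z hzK]
        linarith [mul_nonneg hε.le hSz]
      · have : N z < ε * S z := by
          by_contra! h
          exact hzK ⟨hz, h⟩
        linarith [mul_nonneg (by positivity : 0 ≤ max 1 (1 / δ)) hDz]
    simp only [N, S, D, ← smul_sub, ← smul_add, smul_comm (1 / 2 : ℝ) s⁻¹] at main
    rw [hscale a, hscale b, hscale ((1 / 2 : ℝ) • (a - b)), hscale ((1 / 2 : ℝ) • (a + b))]
    have := mul_le_mul_of_nonneg_left main (by positivity : 0 ≤ s ^ r)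
    linarith

end UniformConvexity

end VarExp

/-! ### The modular of a vector-valued function -/

namespace VarExp

section NormModular

variable {α E : Type*} [MeasurableSpace α] [NormedAddCommGroup E] {μ : Measure α} {p : α → ℝ}
  {q : ℝ}

/-- The modular `∫ ‖f‖ ^ p / p dμ` of a function with values in a normed space. It covers both the
modular of a function and that of its gradient. -/
noncomputable def normModular (μ : Measure α) (p : α → ℝ) (f : α → E) : ℝ≥0∞ :=
  ∫⁻ x, ENNReal.ofReal (‖f x‖ ^ p x / p x) ∂μ

theorem normModular_congr {f g : α → E} (h : f =ᵐ[μ] g) :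
    normModular μ p f = normModular μ p g :=
  lintegral_congr_ae <| h.mono fun x hx => by simp only [hx]

theorem normModular_mono {F : Type*} [NormedAddCommGroup F] {f : α → E} {g : α → F}
    (hp : ∀ᵐ x ∂μ, 0 ≤ p x) (h : ∀ᵐ x ∂μ, ‖f x‖ ≤ ‖g x‖) :
    normModular μ p f ≤ normModular μ p g := by
  refine lintegral_mono_ae ?_
  filter_upwards [hp, h] with x hx hfg
  gcongr

theorem aemeasurable_normModular_integrand (hpm : AEMeasurable p μ) {f : α → E}
    (hf : AEStronglyMeasurable f μ) :
    AEMeasurable (fun x => ENNReal.ofReal (‖f x‖ ^ p x / p x)) μ :=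
  ((hf.norm.aemeasurable.pow hpm).div hpm).ennreal_ofReal

theorem normModular_half_add_le [NormedSpace ℝ E] (hpm : AEMeasurable p μ)
    (hp : ∀ᵐ x ∂μ, 0 ≤ p x) {f : α → E} (hf : AEStronglyMeasurable f μ) (g : α → E) :
    normModular μ p ((1 / 2 : ℝ) • (f + g)) ≤ normModular μ p f + normModular μ p g := by
  unfold normModular
  rw [← lintegral_add_left' (aemeasurable_normModular_integrand hpm hf)]
  refine lintegral_mono_ae ?_
  filter_upwards [hp] with x hx
  have hmax : ‖((1 / 2 : ℝ) • (f + g)) x‖ ≤ max ‖f x‖ ‖g x‖ := by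
    rw [Pi.smul_apply, Pi.add_apply, norm_smul, Real.norm_of_nonneg (by norm_num)]
    linarith [norm_add_le (f x) (g x), le_max_left ‖f x‖ ‖g x‖, le_max_right ‖f x‖ ‖g x‖]
  rcases le_total ‖f x‖ ‖g x‖ with h | h
  · rw [max_eq_right h] at hmax
    refine le_trans ?_ le_add_self
    gcongr
  · rw [max_eq_left h] at hmax
    refine le_trans ?_ le_self_add
    gcongr

theorem normModular_le_liminf (hpm : AEMeasurable p μ) (hp : ∀ᵐ x ∂μ, 0 < p x) {f : ℕ → α → E}
    (hf : ∀ k, AEStronglyMeasurable (f k) μ) {g : α → E}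
    (h : ∀ᵐ x ∂μ, Tendsto (fun k => f k x) atTop (𝓝 (g x))) :
    normModular μ p g ≤ liminf (fun k => normModular μ p (f k)) atTop := by
  refine le_trans (lintegral_mono_ae ?_)
    (lintegral_liminf_le' fun k => aemeasurable_normModular_integrand hpm (hf k))
  filter_upwards [hp, h] with x hx hlim
  refine (Tendsto.liminf_eq ?_).ge
  exact ENNReal.tendsto_ofReal ((hlim.norm.rpow_const (Or.inr hx.le)).div_const _)

theorem exists_subseq_tendsto_zero_ae (hpm : AEMeasurable p μ) (hp : ∀ᵐ x ∂μ, 0 < p x)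
    {f : ℕ → α → E} (hf : ∀ k, AEStronglyMeasurable (f k) μ)
    (h : Tendsto (fun k => normModular μ p (f k)) atTop (𝓝 0)) :
    ∃ ns : ℕ → ℕ, StrictMono ns ∧ ∀ᵐ x ∂μ, Tendsto (fun k => f (ns k) x) atTop (𝓝 0) := by
  have hm : ∀ k, AEStronglyMeasurable (fun x => ‖f k x‖ ^ p x / p x) μ := fun k =>
    (((hf k).norm.aemeasurable.pow hpm).div hpm).aestronglyMeasurable
  have hnorm : ∀ k, eLpNorm ((fun x => ‖f k x‖ ^ p x / p x) - 0) 1 μ = normModular μ p (f k) := by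
    intro k
    rw [sub_zero, eLpNorm_one_eq_lintegral_enorm]
    refine lintegral_congr_ae (hp.mono fun x hx => ?_)
    exact Real.enorm_of_nonneg (by positivity)
  obtain ⟨ns, hns, hae⟩ := (tendstoInMeasure_of_tendsto_eLpNorm (μ := μ) (p := 1) (l := atTop)
    (f := fun k x => ‖f k x‖ ^ p x / p x) (g := 0) one_ne_zero hm
    aestronglyMeasurable_zero (by simpa only [hnorm] using h)).exists_seq_tendsto_ae
  refine ⟨ns, hns, ?_⟩
  filter_upwards [hp, hae] with x hx hlim
  rw [tendsto_zero_iff_norm_tendsto_zero]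
  have h1 := ((hlim.mul_const (p x)).rpow_const (p := (p x)⁻¹) (Or.inr (by positivity)))
  simp only [div_mul_cancel₀ _ hx.ne', Pi.zero_apply, zero_mul,
    Real.zero_rpow (inv_ne_zero hx.ne'), Real.rpow_rpow_inv (norm_nonneg _) hx.ne'] at h1
  exact h1

theorem rpow_le_min_add {t r : ℝ} (hq : 0 < q) (hr : q ≤ r) (ht : 0 ≤ t) :
    t ^ q ≤ min (t ^ q) (2 ^ q) + 2 ^ q * (t ^ r / r) := by
  have hr0 : 0 < r := hq.trans_le hr
  rcases le_total t 2 with h | h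
  · have : t ^ q ≤ 2 ^ q := Real.rpow_le_rpow ht h hq.le
    rw [min_eq_left this]
    have : 0 ≤ 2 ^ q * (t ^ r / r) := by positivity
    linarith
  · have h1 : t ^ q ≤ 2 ^ q * (t ^ r / r) := by
      have ht0 : 0 < t := by linarith
      have h2 : (2 : ℝ) ^ (r - q) ≤ t ^ (r - q) :=
        Real.rpow_le_rpow two_pos.le h (sub_nonneg.2 hr)
      have h3 : r ≤ (2 : ℝ) ^ r := by
        have h5 := one_add_mul_self_le_rpow_one_add (s := 1) (by norm_num) (p := max 1 r)
          (le_max_left _ _)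
        rcases le_total r 1 with h4 | h4
        · exact h4.trans (Real.one_le_rpow one_le_two hr0.le)
        · rw [max_eq_right h4] at h5
          norm_num at h5
          linarith
      rw [Real.rpow_sub two_pos, Real.rpow_sub ht0,
        div_le_div_iff₀ (by positivity) (by positivity)] at h2
      rw [← mul_div_assoc, le_div_iff₀ hr0]
      calc t ^ q * r ≤ t ^ q * 2 ^ r := by gcongr
        _ ≤ 2 ^ q * t ^ r := by linarith
    have : 0 ≤ min (t ^ q) (2 ^ q) := by positivity
    linarith

theorem lintegral_enorm_rpow_le (hq : 0 < q) (hp : ∀ᵐ x ∂μ, q ≤ p x) (hpm : AEMeasurable p μ)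
    {f : α → E} (hf : AEStronglyMeasurable f μ) :
    ∫⁻ x, ‖f x‖ₑ ^ q ∂μ ≤ ∫⁻ x, ENNReal.ofReal (min (‖f x‖ ^ q) (2 ^ q)) ∂μ
      + ENNReal.ofReal (2 ^ q) * normModular μ p f := by
  unfold normModular
  rw [← lintegral_const_mul'' _ (aemeasurable_normModular_integrand hpm hf),
    ← lintegral_add_right' _ ((aemeasurable_normModular_integrand hpm hf).const_mul _)]
  refine lintegral_mono_ae (hp.mono fun x hx => ?_)
  have hx0 : 0 < p x := hq.trans_le hx
  rw [← ofReal_norm, ENNReal.ofReal_rpow_of_nonneg (norm_nonneg _) hq.le,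
    ← ENNReal.ofReal_mul (by positivity), ← ENNReal.ofReal_add (by positivity) (by positivity)]
  exact ENNReal.ofReal_le_ofReal (rpow_le_min_add hq hx (norm_nonneg _))

theorem memLp_of_normModular_lt_top [IsFiniteMeasure μ] (hq : 0 < q) (hp : ∀ᵐ x ∂μ, q ≤ p x)
    (hpm : AEMeasurable p μ) {f : α → E} (hf : AEStronglyMeasurable f μ)
    (h : normModular μ p f < ⊤) : MemLp f (ENNReal.ofReal q) μ := by
  refine ⟨hf, ?_⟩
  rw [eLpNorm_lt_top_iff_lintegral_rpow_enorm_lt_top (by simpa using hq) ENNReal.ofReal_ne_top,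
    ENNReal.toReal_ofReal hq.le]
  refine (lintegral_enorm_rpow_le hq hp hpm hf).trans_lt (ENNReal.add_lt_top.2 ⟨?_, ?_⟩)
  · refine (lintegral_mono (g := fun _ => ENNReal.ofReal (2 ^ q)) fun x =>
      ENNReal.ofReal_le_ofReal (min_le_right _ _)).trans_lt ?_
    rw [lintegral_const]
    exact ENNReal.mul_lt_top ENNReal.ofReal_lt_top (measure_lt_top _ _)
  · exact ENNReal.mul_lt_top ENNReal.ofReal_lt_top h

/-- Modular convergence implies convergence in `L^q` when `p ≥ q`. Where `p` is large the integrand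
`‖f‖ ^ p / p` controls `‖f‖ ^ q` only above a fixed height; below it, dominated convergence along
almost everywhere convergent subsequences is used. -/
theorem tendsto_eLpNorm_of_normModular [IsFiniteMeasure μ] {ι : Type*} {l : Filter ι}
    [l.IsCountablyGenerated] (hq : 0 < q) (hp : ∀ᵐ x ∂μ, q ≤ p x)
    (hpm : AEMeasurable p μ) {f : ι → α → E} (hf : ∀ i, AEStronglyMeasurable (f i) μ)
    (h : Tendsto (fun i => normModular μ p (f i)) l (𝓝 0)) :
    Tendsto (fun i => eLpNorm (f i) (ENNReal.ofReal q) μ) l (𝓝 0) := by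
  have hp0 : ∀ᵐ x ∂μ, 0 < p x := hp.mono fun x hx => hq.trans_le hx
  suffices H : Tendsto (fun i => ∫⁻ x, ‖f i x‖ₑ ^ q ∂μ) l (𝓝 0) by
    have := (ENNReal.continuous_rpow_const (y := 1 / q)).tendsto 0 |>.comp H
    rw [ENNReal.zero_rpow_of_pos (by positivity)] at this
    refine this.congr fun i => ?_
    rw [eLpNorm_eq_lintegral_rpow_enorm_toReal (by simpa using hq) ENNReal.ofReal_ne_top,
      ENNReal.toReal_ofReal hq.le]
    rfl
  refine tendsto_of_subseq_tendsto fun ns hns => ?_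
  obtain ⟨ms, hms, hae⟩ := exists_subseq_tendsto_zero_ae hpm hp0 (fun k => hf (ns k)) (h.comp hns)
  refine ⟨ms, ?_⟩
  have h1 : Tendsto (fun k => ∫⁻ x, ENNReal.ofReal (min (‖f (ns (ms k)) x‖ ^ q) (2 ^ q)) ∂μ)
      atTop (𝓝 (∫⁻ _, 0 ∂μ)) := by
    refine tendsto_lintegral_of_dominated_convergence' (fun _ => ENNReal.ofReal (2 ^ q))
      (fun k => ?_) (fun k => ?_) ?_ ?_
    · exact (((hf _).norm.aemeasurable.pow_const q).min aemeasurable_const).ennreal_ofReal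
    · exact Eventually.of_forall fun x => ENNReal.ofReal_le_ofReal (min_le_right _ _)
    · rw [lintegral_const]
      exact (ENNReal.mul_lt_top ENNReal.ofReal_lt_top (measure_lt_top _ _)).ne
    · filter_upwards [hae] with x hx
      have h2 := (hx.norm.rpow_const (p := q) (Or.inr hq.le)).min
        (tendsto_const_nhds (x := (2 : ℝ) ^ q))
      rw [norm_zero, Real.zero_rpow hq.ne', min_eq_left (by positivity)] at h2
      simpa using ENNReal.tendsto_ofReal h2
  have h2 : Tendsto (fun k => ENNReal.ofReal (2 ^ q) * normModular μ p (f (ns (ms k)))) atTop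
      (𝓝 (ENNReal.ofReal (2 ^ q) * 0)) :=
    ENNReal.Tendsto.const_mul (h.comp (hns.comp hms.tendsto_atTop)) (Or.inr ENNReal.ofReal_ne_top)
  have h3 := h1.add h2
  rw [lintegral_zero, mul_zero, add_zero] at h3
  exact tendsto_of_tendsto_of_tendsto_of_le_of_le tendsto_const_nhds h3 (fun _ => zero_le)
    fun k => lintegral_enorm_rpow_le hq hp hpm (hf _)

/-- Uniform convexity of the modular. -/
theorem exists_normModular_half_sub_le {E : Type*} [NormedAddCommGroup E] [InnerProductSpace ℝ E]
    [FiniteDimensional ℝ E] (hq : 1 < q) (hp : ∀ᵐ x ∂μ, q ≤ p x) (hpm : AEMeasurable p μ) {ε : ℝ}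
    (hε : 0 < ε) :
    ∃ C : ℝ, 0 < C ∧ ∀ f g : α → E, AEStronglyMeasurable f μ → AEStronglyMeasurable g μ →
      normModular μ p ((1 / 2 : ℝ) • (f - g))
          + ENNReal.ofReal C * normModular μ p ((1 / 2 : ℝ) • (f + g))
        ≤ ENNReal.ofReal (ε + C / 2) * (normModular μ p f + normModular μ p g) := by
  obtain ⟨C, hC, H⟩ := exists_norm_half_sub_rpow_le (E := E) hq hε
  refine ⟨C, hC, fun f g hf hg => ?_⟩
  have m := fun {h : α → E} (hh : AEStronglyMeasurable h μ) =>
    aemeasurable_normModular_integrand hpm hh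
  have madd : AEMeasurable (fun x => ENNReal.ofReal (‖f x‖ ^ p x / p x)
      + ENNReal.ofReal (‖g x‖ ^ p x / p x)) μ := (m hf).add (m hg)
  unfold normModular
  rw [← lintegral_const_mul'' _ (m ((hf.add hg).const_smul _)), ← lintegral_add_left' (m hf),
    ← lintegral_const_mul'' _ madd,
    ← lintegral_add_left' (m ((hf.sub hg).const_smul _))]
  refine lintegral_mono_ae (hp.mono fun x hx => ?_)
  have hx0 : 0 < p x := by linarith
  simp only [Pi.smul_apply, Pi.add_apply, Pi.sub_apply]
  rw [← ENNReal.ofReal_mul hC.le, ← ENNReal.ofReal_add (by positivity) (by positivity),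
    ← ENNReal.ofReal_add (by positivity) (by positivity), ← ENNReal.ofReal_mul (by positivity)]
  refine ENNReal.ofReal_le_ofReal ?_
  have := div_le_div_of_nonneg_right (H (p x) hx (f x) (g x)) hx0.le
  calc _ = (‖(1 / 2 : ℝ) • (f x - g x)‖ ^ p x + C * ‖(1 / 2 : ℝ) • (f x + g x)‖ ^ p x) / p x := by
        ring
    _ ≤ _ := this
    _ = _ := by ring

/-- A minimizing sequence for the modular over a midpoint-convex class is Cauchy with respect to
the modular of half the difference. -/
theorem tendsto_normModular_half_sub {E : Type*} [NormedAddCommGroup E] [InnerProductSpace ℝ E]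
    [FiniteDimensional ℝ E] (hq : 1 < q) (hp : ∀ᵐ x ∂μ, q ≤ p x) (hpm : AEMeasurable p μ)
    {f : ℕ → α → E} (hf : ∀ k, AEStronglyMeasurable (f k) μ) {I : ℝ≥0∞} (hI : I ≠ ⊤)
    (hlim : Tendsto (fun k => normModular μ p (f k)) atTop (𝓝 I))
    (hmid : ∀ j k, I ≤ normModular μ p ((1 / 2 : ℝ) • (f j + f k))) :
    Tendsto (fun z : ℕ × ℕ => normModular μ p ((1 / 2 : ℝ) • (f z.1 - f z.2))) atTop (𝓝 0) := by
  rw [ENNReal.tendsto_nhds_zero]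
  intro η hη
  rcases eq_or_ne η ⊤ with rfl | hη'
  · simp
  lift I to NNReal using hI
  lift η to NNReal using hη'
  have hη0 : (0 : ℝ) < η := by exact_mod_cast hη
  set ε : ℝ := η / (4 * (I + 1)) with hε
  obtain ⟨C, hC, H⟩ := exists_normModular_half_sub_le (E := E) hq hp hpm
    (ε := ε) (by positivity)
  -- The excess over the infimum is taken so small that `C` times it is negligible.
  set δ : ℝ := min 1 (η / (2 * C)) with hδ
  have hδ0 : 0 < δ := by positivity
  have hlt : ∀ᶠ k in atTop, normModular μ p (f k) ≤ ENNReal.ofReal (I + δ) := by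
    refine (hlim.eventually_lt_const (u := ENNReal.ofReal (I + δ)) ?_).mono fun k hk => hk.le
    rw [← ENNReal.ofReal_coe_nnreal]
    exact (ENNReal.ofReal_lt_ofReal_iff (by positivity)).2 (by linarith)
  have hlt2 := hlt.prod_mk hlt
  rw [prod_atTop_atTop_eq] at hlt2
  filter_upwards [hlt2] with z hz
  have h1 := H _ _ (hf z.1) (hf z.2)
  have h2 : normModular μ p ((1 / 2 : ℝ) • (f z.1 - f z.2)) + ENNReal.ofReal (C * I)
      ≤ ENNReal.ofReal ((ε + C / 2) * ((I + δ) + (I + δ))) := by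
    rw [ENNReal.ofReal_mul hC.le, ENNReal.ofReal_coe_nnreal, ENNReal.ofReal_mul (by positivity),
      ENNReal.ofReal_add (p := I + δ) (by positivity) (by positivity)]
    refine le_trans ?_ (h1.trans ?_)
    · gcongr; exact hmid _ _
    · gcongr; exacts [hz.1, hz.2]
  have h3 : ENNReal.ofReal ((ε + C / 2) * ((I + δ) + (I + δ)))
      ≤ η + ENNReal.ofReal (C * I) := by
    rw [← ENNReal.ofReal_coe_nnreal, ← ENNReal.ofReal_add (by positivity) (by positivity)]
    refine ENNReal.ofReal_le_ofReal ?_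
    have e1 : ε * (2 * (I + 1)) = η / 2 := by rw [hε]; field_simp; norm_num
    have e2 : ε * (2 * (I + δ)) ≤ ε * (2 * (I + 1)) := by gcongr; exact min_le_left _ _
    have e3 : C * δ ≤ η / 2 :=
      calc C * δ ≤ C * (η / (2 * C)) := by gcongr; exact min_le_right _ _
        _ = η / 2 := by field_simp
    nlinarith
  exact (ENNReal.add_le_add_iff_right ENNReal.ofReal_ne_top).1 (h2.trans h3)

end NormModular

end VarExp

/-! ### Calculus of distributional gradients -/

namespace VarExp

section WeakGradient

variable {n : ℕ} {Ω : Set (EuclideanSpace ℝ (Fin n))} {u v : EuclideanSpace ℝ (Fin n) → ℝ}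
  {G H : EuclideanSpace ℝ (Fin n) → EuclideanSpace ℝ (Fin n)}
  {η : EuclideanSpace ℝ (Fin n) → ℝ}

theorem integrable_smul_of_tsupport_subset {F : Type*} [NormedAddCommGroup F] [NormedSpace ℝ F]
    {f : EuclideanSpace ℝ (Fin n) → F} (hf : LocallyIntegrableOn f Ω) (hη : Continuous η)
    (hc : HasCompactSupport η) (hs : tsupport η ⊆ Ω) : Integrable (fun x => η x • f x) := by
  have h1 : IntegrableOn f (tsupport η) := hf.integrableOn_compact_subset hs hc
  have h2 := h1.continuousOn_smul hη.continuousOn hc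
  refine (integrableOn_iff_integrable_of_support_subset ?_).1 h2
  exact (Function.support_smul_subset_left η f).trans (subset_tsupport η)

theorem continuous_fderiv_apply_of_test (hη : η ∈ testFunctions Ω) (e : EuclideanSpace ℝ (Fin n)) :
    Continuous fun x => fderiv ℝ η x e :=
  (hη.1.continuous_fderiv (by simp)).clm_apply continuous_const

theorem hasCompactSupport_fderiv_apply_of_test (hη : η ∈ testFunctions Ω)
    (e : EuclideanSpace ℝ (Fin n)) : HasCompactSupport fun x => fderiv ℝ η x e :=
  hη.2.1.fderiv_apply ℝ e

theorem tsupport_fderiv_apply_subset_of_test (hη : η ∈ testFunctions Ω)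
    (e : EuclideanSpace ℝ (Fin n)) : tsupport (fun x => fderiv ℝ η x e) ⊆ Ω :=
  (tsupport_fderiv_apply_subset ℝ e).trans hη.2.2

theorem HasWeakGradient.integrable_left (h : HasWeakGradient Ω u G) (hη : η ∈ testFunctions Ω)
    (e : EuclideanSpace ℝ (Fin n)) : Integrable fun x => u x * fderiv ℝ η x e := by
  simp only [mul_comm (u _)]
  exact integrable_smul_of_tsupport_subset h.1 (continuous_fderiv_apply_of_test hη e)
    (hasCompactSupport_fderiv_apply_of_test hη e) (tsupport_fderiv_apply_subset_of_test hη e)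

theorem HasWeakGradient.integrable_right (h : HasWeakGradient Ω u G) (hη : η ∈ testFunctions Ω)
    (e : EuclideanSpace ℝ (Fin n)) : Integrable fun x => inner ℝ (G x) e * η x := by
  have := (integrable_smul_of_tsupport_subset h.2.1 hη.1.continuous hη.2.1
    hη.2.2).inner_const (𝕜 := ℝ) e
  simpa only [real_inner_smul_left, mul_comm] using this

theorem HasWeakGradient.add (hu : HasWeakGradient Ω u G) (hv : HasWeakGradient Ω v H) :
    HasWeakGradient Ω (u + v) (G + H) := by
  refine ⟨hu.1.add hv.1, hu.2.1.add hv.2.1, fun η hη e => ?_⟩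
  simp only [Pi.add_apply, add_mul, inner_add_left]
  rw [integral_add (hu.integrable_left hη e).restrict (hv.integrable_left hη e).restrict,
    integral_add (hu.integrable_right hη e).restrict (hv.integrable_right hη e).restrict,
    hu.2.2 η hη e, hv.2.2 η hη e, neg_add]

theorem HasWeakGradient.const_smul (hu : HasWeakGradient Ω u G) (c : ℝ) :
    HasWeakGradient Ω (c • u) (c • G) := by
  refine ⟨hu.1.smul c, hu.2.1.smul c, fun η hη e => ?_⟩
  simp only [Pi.smul_apply, smul_eq_mul, real_inner_smul_left, mul_assoc]
  rw [integral_const_mul, integral_const_mul, hu.2.2 η hη e, mul_neg]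

theorem HasWeakGradient.sub (hu : HasWeakGradient Ω u G) (hv : HasWeakGradient Ω v H) :
    HasWeakGradient Ω (u - v) (G - H) := by
  simpa only [sub_eq_add_neg, neg_one_smul] using hu.add (hv.const_smul (-1))

theorem HasWeakGradient.ae_eq (hΩ : IsOpen Ω) (h₁ : HasWeakGradient Ω u G)
    (h₂ : HasWeakGradient Ω u H) : G =ᵐ[volume.restrict Ω] H := by
  have h := h₁.sub h₂
  rw [Filter.EventuallyEq, ae_restrict_iff' hΩ.measurableSet]
  refine (hΩ.ae_eq_zero_of_integral_contDiff_smul_eq_zero h.2.1 fun g hg hgc hgs => ?_).mono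
    fun x hx hxΩ => sub_eq_zero.1 (hx hxΩ)
  have hint := integrable_smul_of_tsupport_subset h.2.1 hg.continuous hgc hgs
  refine ext_inner_left ℝ fun e => ?_
  rw [← integral_inner hint, inner_zero_right]
  have h0 := h.2.2 g ⟨hg, hgc, hgs⟩ e
  simp only [sub_self, Pi.zero_apply, zero_mul, integral_zero] at h0
  rw [← neg_eq_zero, h0]
  congr 1
  rw [setIntegral_eq_integral_of_forall_compl_eq_zero fun x hx => by
    rw [image_eq_zero_of_notMem_tsupport fun hx' => hx (hgs hx'), mul_zero]]
  refine integral_congr_ae (Eventually.of_forall fun x => ?_)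
  simp only [real_inner_smul_right, real_inner_comm e]
  exact mul_comm _ _

theorem hasWeakGradient_weakGradient (h : ∃ G, HasWeakGradient Ω u G) :
    HasWeakGradient Ω u (weakGradient Ω u) := by
  unfold weakGradient
  rw [dif_pos h]
  exact h.choose_spec

theorem HasWeakGradient.weakGradient_ae_eq (hΩ : IsOpen Ω) (h : HasWeakGradient Ω u G) :
    weakGradient Ω u =ᵐ[volume.restrict Ω] G :=
  (hasWeakGradient_weakGradient ⟨G, h⟩).ae_eq hΩ h

theorem continuous_gradient_of_test (hη : η ∈ testFunctions Ω) : Continuous (gradient η) :=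
  (InnerProductSpace.toDual ℝ (EuclideanSpace ℝ (Fin n))).symm.continuous.comp
    (hη.1.continuous_fderiv (by simp))

theorem inner_gradient_eq_fderiv (x e : EuclideanSpace ℝ (Fin n)) :
    inner ℝ (gradient η x) e = fderiv ℝ η x e := by
  simp [gradient]

theorem norm_gradient_eq_norm_fderiv (x : EuclideanSpace ℝ (Fin n)) :
    ‖gradient η x‖ = ‖fderiv ℝ η x‖ := by
  simp [gradient]

theorem gradient_eq_zero_of_notMem_tsupport {x : EuclideanSpace ℝ (Fin n)}
    (hx : x ∉ tsupport η) : gradient η x = 0 := by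
  have : fderiv ℝ η x = 0 :=
    image_eq_zero_of_notMem_tsupport fun h => hx (tsupport_fderiv_subset ℝ h)
  rw [← norm_eq_zero, norm_gradient_eq_norm_fderiv, this, norm_zero]

theorem hasCompactSupport_gradient_of_test (hη : η ∈ testFunctions Ω) :
    HasCompactSupport (gradient η) :=
  hη.2.1.mono' fun _ hx => by_contra fun h => hx (gradient_eq_zero_of_notMem_tsupport h)

theorem hasWeakGradient_of_test (hη : η ∈ testFunctions Ω) :
    HasWeakGradient Ω η (gradient η) := by
  have hcg := continuous_gradient_of_test hη
  refine ⟨(hη.1.continuous.locallyIntegrable).locallyIntegrableOn Ω,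
    (hcg.locallyIntegrable).locallyIntegrableOn Ω, fun ζ hζ e => ?_⟩
  simp only [inner_gradient_eq_fderiv]
  have hz : ∀ x, x ∉ Ω → ζ x = 0 := fun x hx =>
    image_eq_zero_of_notMem_tsupport fun h => hx (hζ.2.2 h)
  have hz' : ∀ x, x ∉ Ω → fderiv ℝ ζ x e = 0 := fun x hx =>
    image_eq_zero_of_notMem_tsupport (f := fun x => fderiv ℝ ζ x e)
      fun h => hx (tsupport_fderiv_apply_subset_of_test hζ e h)
  rw [setIntegral_eq_integral_of_forall_compl_eq_zero fun x hx => by rw [hz' x hx, mul_zero],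
    setIntegral_eq_integral_of_forall_compl_eq_zero fun x hx => by rw [hz x hx, mul_zero]]
  have hcη := continuous_fderiv_apply_of_test hη e
  have hcζ := continuous_fderiv_apply_of_test hζ e
  refine integral_mul_fderiv_eq_neg_fderiv_mul_of_integrable ?_ ?_ ?_
    (fun x _ => hη.1.differentiable (by simp) x) (fun x _ => hζ.1.differentiable (by simp) x)
  · exact (hcη.mul hζ.1.continuous).integrable_of_hasCompactSupport hζ.2.1.mul_left
  · exact (hη.1.continuous.mul hcζ).integrable_of_hasCompactSupport hη.2.1.mul_right
  · exact (hη.1.continuous.mul hζ.1.continuous).integrable_of_hasCompactSupport hζ.2.1.mul_left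

theorem tendsto_setIntegral_mul_of_eLpNorm {f : ℕ → EuclideanSpace ℝ (Fin n) → ℝ}
    {g ψ : EuclideanSpace ℝ (Fin n) → ℝ} (hψ : Continuous ψ) (hψc : HasCompactSupport ψ)
    (hf : ∀ k, Integrable fun x => f k x * ψ x) (hg : Integrable fun x => g x * ψ x)
    (h : Tendsto (fun k => eLpNorm (f k - g) 1 (volume.restrict Ω)) atTop (𝓝 0)) :
    Tendsto (fun k => ∫ x in Ω, f k x * ψ x) atTop (𝓝 (∫ x in Ω, g x * ψ x)) := by
  obtain ⟨C, hC⟩ := hψc.exists_bound_of_continuous hψ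
  refine tendsto_integral_of_L1' _ hg.restrict.aestronglyMeasurable
    (Eventually.of_forall fun k => (hf k).restrict) ?_
  have h0 : Tendsto (fun k => ENNReal.ofReal C * eLpNorm (f k - g) 1 (volume.restrict Ω)) atTop
      (𝓝 (ENNReal.ofReal C * 0)) :=
    ENNReal.Tendsto.const_mul h (Or.inr ENNReal.ofReal_ne_top)
  rw [mul_zero] at h0
  refine tendsto_of_tendsto_of_tendsto_of_le_of_le tendsto_const_nhds h0 (fun _ => zero_le)
    fun k => ?_
  refine eLpNorm_le_mul_eLpNorm_of_ae_le_mul (Eventually.of_forall fun x => ?_) 1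
  simp only [Pi.sub_apply, ← sub_mul]
  rw [norm_mul, mul_comm]
  gcongr
  exact hC x

/-- Distributional gradients are stable under convergence in `L¹`. -/
theorem HasWeakGradient.of_tendsto {w : ℕ → EuclideanSpace ℝ (Fin n) → ℝ}
    {W : ℕ → EuclideanSpace ℝ (Fin n) → EuclideanSpace ℝ (Fin n)}
    (hw : ∀ k, HasWeakGradient Ω (w k) (W k)) (hu : IntegrableOn u Ω) (hG : IntegrableOn G Ω)
    (hwu : Tendsto (fun k => eLpNorm (w k - u) 1 (volume.restrict Ω)) atTop (𝓝 0))
    (hWG : Tendsto (fun k => eLpNorm (W k - G) 1 (volume.restrict Ω)) atTop (𝓝 0)) :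
    HasWeakGradient Ω u G := by
  refine ⟨hu.locallyIntegrableOn, hG.locallyIntegrableOn, fun η hη e => ?_⟩
  have h1 : Tendsto (fun k => ∫ x in Ω, w k x * fderiv ℝ η x e) atTop
      (𝓝 (∫ x in Ω, u x * fderiv ℝ η x e)) := by
    refine tendsto_setIntegral_mul_of_eLpNorm (continuous_fderiv_apply_of_test hη e)
      (hasCompactSupport_fderiv_apply_of_test hη e) (fun k => (hw k).integrable_left hη e) ?_ hwu
    simp only [mul_comm (u _)]
    exact integrable_smul_of_tsupport_subset hu.locallyIntegrableOn
      (continuous_fderiv_apply_of_test hη e) (hasCompactSupport_fderiv_apply_of_test hη e)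
      (tsupport_fderiv_apply_subset_of_test hη e)
  have h2 : Tendsto (fun k => ∫ x in Ω, inner ℝ (W k x) e * η x) atTop
      (𝓝 (∫ x in Ω, inner ℝ (G x) e * η x)) := by
    refine tendsto_setIntegral_mul_of_eLpNorm (f := fun k x => inner ℝ (W k x) e)
      (g := fun x => inner ℝ (G x) e) hη.1.continuous hη.2.1
      (fun k => (hw k).integrable_right hη e) ?_ ?_
    · have := (integrable_smul_of_tsupport_subset hG.locallyIntegrableOn hη.1.continuous hη.2.1
        hη.2.2).inner_const (𝕜 := ℝ) e
      simpa only [real_inner_smul_left, mul_comm] using this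
    · have h0 : Tendsto (fun k => ENNReal.ofReal ‖e‖ * eLpNorm (W k - G) 1 (volume.restrict Ω))
          atTop (𝓝 (ENNReal.ofReal ‖e‖ * 0)) :=
        ENNReal.Tendsto.const_mul hWG (Or.inr ENNReal.ofReal_ne_top)
      rw [mul_zero] at h0
      refine tendsto_of_tendsto_of_tendsto_of_le_of_le tendsto_const_nhds h0 (fun _ => zero_le)
        fun k => ?_
      refine eLpNorm_le_mul_eLpNorm_of_ae_le_mul (Eventually.of_forall fun x => ?_) 1
      simp only [Pi.sub_apply, ← inner_sub_left]
      rw [mul_comm]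
      exact norm_inner_le_norm _ _
  exact tendsto_nhds_unique h1 (h2.neg.congr fun k => ((hw k).2.2 η hη e).symm)

end WeakGradient

end VarExp

/-! ### Morrey's estimate for test functions -/

namespace VarExp

section Morrey

variable {n : ℕ} {Ω : Set (EuclideanSpace ℝ (Fin n))} {η : EuclideanSpace ℝ (Fin n) → ℝ}

theorem lintegral_comp_add_smul (f : EuclideanSpace ℝ (Fin n) → ℝ≥0∞) (hf : Measurable f)
    (x : EuclideanSpace ℝ (Fin n)) {t : ℝ} (ht : 0 < t) :
    ∫⁻ y, f (x + t • y) = ENNReal.ofReal (t ^ (-(n : ℝ))) * ∫⁻ y, f y := by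
  have h1 : ∫⁻ y, f (x + t • y) = ∫⁻ z, f (x + z) ∂(Measure.map (fun y => t • y) volume) :=
    (lintegral_map (f := fun z => f (x + z)) (hf.comp (measurable_const_add x))
      (measurable_const_smul t)).symm
  rw [h1, Measure.map_addHaar_smul _ ht.ne', lintegral_smul_measure, lintegral_add_left_eq_self]
  simp only [finrank_euclideanSpace, Fintype.card_fin, smul_eq_mul]
  rw [abs_of_pos (by positivity), Real.rpow_neg ht.le, Real.rpow_natCast]

theorem eLpNorm_fderiv_comp_add_smul {q : ℝ} (hq : 0 < q) (hη : η ∈ testFunctions Ω)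
    (x : EuclideanSpace ℝ (Fin n)) {t : ℝ} (ht : 0 < t) :
    eLpNorm (fun y => fderiv ℝ η (x + t • y)) (ENNReal.ofReal q) volume
      = ENNReal.ofReal (t ^ (-(n / q : ℝ))) * eLpNorm (fderiv ℝ η) (ENNReal.ofReal q) volume := by
  have hq0 : ENNReal.ofReal q ≠ 0 := by simpa using hq
  have hm : Measurable fun y => ‖fderiv ℝ η y‖ₑ ^ q :=
    (hη.1.continuous_fderiv (by simp)).enorm.measurable.pow_const q
  rw [eLpNorm_eq_lintegral_rpow_enorm_toReal hq0 ENNReal.ofReal_ne_top,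
    eLpNorm_eq_lintegral_rpow_enorm_toReal hq0 ENNReal.ofReal_ne_top, ENNReal.toReal_ofReal hq.le,
    lintegral_comp_add_smul (fun y => ‖fderiv ℝ η y‖ₑ ^ q) hm x ht,
    ENNReal.mul_rpow_of_nonneg _ _ (by positivity),
    ENNReal.ofReal_rpow_of_nonneg (by positivity) (by positivity), ← Real.rpow_mul ht.le]
  congr 3
  ring

theorem enorm_le_lintegral_segment (hη : η ∈ testFunctions Ω) {x y : EuclideanSpace ℝ (Fin n)}
    (hxy : x + y ∉ Ω) :
    ‖η x‖ₑ ≤ ∫⁻ t in Set.Ioc (0 : ℝ) 1, ‖fderiv ℝ η (x + t • y)‖ₑ * ‖y‖ₑ := by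
  have hcont : Continuous fun t : ℝ => fderiv ℝ η (x + t • y) y :=
    (continuous_fderiv_apply_of_test hη y).comp (by fun_prop)
  have hder : ∀ t : ℝ, HasDerivAt (fun t : ℝ => η (x + t • y)) (fderiv ℝ η (x + t • y) y) t := by
    intro t
    have h1 : HasDerivAt (fun t : ℝ => x + t • y) y t := by
      simpa using ((hasDerivAt_id t).smul_const y).const_add x
    exact ((hη.1.differentiable (by simp)) (x + t • y)).hasFDerivAt.comp_hasDerivAt t h1
  have h0 := intervalIntegral.integral_eq_sub_of_hasDerivAt (a := 0) (b := 1)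
    (fun t _ => hder t) (hcont.intervalIntegrable 0 1)
  simp only [one_smul, zero_smul, add_zero] at h0
  rw [image_eq_zero_of_notMem_tsupport (fun h => hxy (hη.2.2 h)), zero_sub,
    intervalIntegral.integral_of_le zero_le_one] at h0
  rw [← enorm_neg, ← h0]
  refine (enorm_integral_le_lintegral_enorm _).trans (lintegral_mono fun t => ?_)
  exact ContinuousLinearMap.le_opENorm _ _

/-- Morrey's estimate: for `q > n`, the supremum of a test function on a bounded set is controlled
by the `L^q` norm of its gradient. The value `η x` is written as an integral of the derivative
along the segments from `x` to the points `x + y`, where `y` runs through a fixed ball that is so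
far from the origin that these points lie outside `Ω`. Averaging over `y` and rescaling produces
the factor `t ^ (-n / q)`, which is integrable near `0` because `q > n`. -/
theorem exists_enorm_le_eLpNorm_gradient (hn : 1 ≤ n) (hΩ : Bornology.IsBounded Ω) {q : ℝ}
    (hq : (n : ℝ) < q) :
    ∃ C : ℝ≥0∞, C ≠ ⊤ ∧ ∀ η ∈ testFunctions Ω, ∀ x,
      ‖η x‖ₑ ≤ C * eLpNorm (gradient η) (ENNReal.ofReal q) (volume.restrict Ω) := by
  have hn1 : (1 : ℝ) ≤ n := by exact_mod_cast hn
  have hq0 : 0 < q := by linarith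
  obtain ⟨R, hR, hΩR⟩ := hΩ.subset_ball_lt 0 0
  have : Nonempty (Fin n) := ⟨⟨0, hn⟩⟩
  obtain ⟨c, hc⟩ := exists_norm_eq (EuclideanSpace ℝ (Fin n)) (c := 3 * R) (by positivity)
  set A := Metric.ball c R with hA
  have hA0 : volume A ≠ 0 := (Metric.measure_ball_pos _ _ hR).ne'
  have hAt : volume A ≠ ⊤ := measure_ball_lt_top.ne
  set T := ∫⁻ t in Set.Ioc (0 : ℝ) 1, ENNReal.ofReal (t ^ (-(n / q : ℝ))) with hT
  have hTt : T ≠ ⊤ := by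
    have h1 : IntervalIntegrable (fun t : ℝ => t ^ (-(n / q : ℝ))) volume 0 1 :=
      intervalIntegral.intervalIntegrable_rpow' (by
        rw [neg_lt_neg_iff, div_lt_one hq0]; exact hq)
    rw [intervalIntegrable_iff_integrableOn_Ioc_of_le zero_le_one] at h1
    refine ((lintegral_mono_ae ?_).trans_lt h1.2).ne
    exact Eventually.of_forall fun t => Real.ofReal_le_enorm _
  set e : ℝ := 1 / (1 : ℝ≥0∞).toReal - 1 / (ENNReal.ofReal q).toReal with he
  have he0 : 0 ≤ e := by
    rw [he, ENNReal.toReal_ofReal hq0.le, ENNReal.toReal_one, sub_nonneg]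
    exact one_div_le_one_div_of_le one_pos (by linarith)
  refine ⟨(volume A)⁻¹ * (ENNReal.ofReal (4 * R) * (T * volume A ^ e)), ?_, fun η hη x => ?_⟩
  · exact ENNReal.mul_ne_top (ENNReal.inv_ne_top.2 hA0) (ENNReal.mul_ne_top ENNReal.ofReal_ne_top
      (ENNReal.mul_ne_top hTt (ENNReal.rpow_ne_top_of_nonneg he0 hAt)))
  by_cases hx : x ∈ Ω
  swap
  · rw [image_eq_zero_of_notMem_tsupport fun h => hx (hη.2.2 h), enorm_zero]
    exact zero_le
  set N := eLpNorm (fderiv ℝ η) (ENNReal.ofReal q) volume with hN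
  have hNeq : eLpNorm (gradient η) (ENNReal.ofReal q) (volume.restrict Ω) = N := by
    rw [eLpNorm_restrict_eq_of_support_subset fun y hy => by_contra fun h =>
      hy (gradient_eq_zero_of_notMem_tsupport fun h' => h (hη.2.2 h'))]
    exact eLpNorm_congr_norm_ae (Eventually.of_forall norm_gradient_eq_norm_fderiv)
  have hcf : Continuous (fderiv ℝ η) := hη.1.continuous_fderiv (by simp)
  have hyA : ∀ y ∈ A, 2 * R ≤ ‖y‖ ∧ ‖y‖ ≤ 4 * R := by
    intro y hy
    rw [hA, mem_ball_iff_norm] at hy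
    have h1 := norm_sub_norm_le c y
    have h2 := norm_sub_norm_le y c
    rw [norm_sub_rev] at h1
    constructor <;> linarith
  have hpt : ∀ y ∈ A, ‖η x‖ₑ ≤
      ENNReal.ofReal (4 * R) * ∫⁻ t in Set.Ioc (0 : ℝ) 1, ‖fderiv ℝ η (x + t • y)‖ₑ := by
    intro y hy
    refine (enorm_le_lintegral_segment hη (y := y) fun h => ?_).trans ?_
    · have h1 := mem_ball_zero_iff.1 (hΩR h)
      have h2 := mem_ball_zero_iff.1 (hΩR hx)
      have h3 := norm_sub_le (x + y) x
      rw [add_sub_cancel_left] at h3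
      linarith [(hyA y hy).1]
    · rw [lintegral_mul_const' _ _ enorm_ne_top, mul_comm]
      gcongr
      rw [← ofReal_norm]
      exact ENNReal.ofReal_le_ofReal (hyA y hy).2
  have hslice : ∀ t ∈ Set.Ioc (0 : ℝ) 1, ∫⁻ y in A, ‖fderiv ℝ η (x + t • y)‖ₑ ≤
      ENNReal.ofReal (t ^ (-(n / q : ℝ))) * (N * volume A ^ e) := by
    intro t ht
    have h1 := eLpNorm_le_eLpNorm_mul_rpow_measure_univ (μ := volume.restrict A) (p := 1)
      (q := ENNReal.ofReal q) (f := fun y => fderiv ℝ η (x + t • y))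
      (by rw [← ENNReal.ofReal_one]; exact ENNReal.ofReal_le_ofReal (by linarith))
      (hcf.comp (by fun_prop)).aestronglyMeasurable
    rw [eLpNorm_one_eq_lintegral_enorm, Measure.restrict_apply_univ] at h1
    refine h1.trans ?_
    rw [← mul_assoc, ← eLpNorm_fderiv_comp_add_smul hq0 hη x ht.1]
    gcongr
    exact Measure.restrict_le_self
  have hmeas : Measurable fun z : EuclideanSpace ℝ (Fin n) × ℝ => ‖fderiv ℝ η (x + z.2 • z.1)‖ₑ :=
    (hcf.comp (by fun_prop)).enorm.measurable
  have hmain : volume A * ‖η x‖ₑ ≤ ENNReal.ofReal (4 * R) * (T * (N * volume A ^ e)) :=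
    calc volume A * ‖η x‖ₑ = ∫⁻ _ in A, ‖η x‖ₑ := by
          rw [setLIntegral_const, mul_comm]
      _ ≤ ∫⁻ y in A, ENNReal.ofReal (4 * R) *
            ∫⁻ t in Set.Ioc (0 : ℝ) 1, ‖fderiv ℝ η (x + t • y)‖ₑ :=
          setLIntegral_mono' measurableSet_ball hpt
      _ = ENNReal.ofReal (4 * R) *
            ∫⁻ t in Set.Ioc (0 : ℝ) 1, ∫⁻ y in A, ‖fderiv ℝ η (x + t • y)‖ₑ := by
          rw [lintegral_const_mul' _ _ ENNReal.ofReal_ne_top,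
            lintegral_lintegral_swap hmeas.aemeasurable]
      _ ≤ ENNReal.ofReal (4 * R) *
            ∫⁻ t in Set.Ioc (0 : ℝ) 1,
              ENNReal.ofReal (t ^ (-(n / q : ℝ))) * (N * volume A ^ e) := by
          gcongr ENNReal.ofReal (4 * R) * ?_
          exact setLIntegral_mono' measurableSet_Ioc hslice
      _ = ENNReal.ofReal (4 * R) * (T * (N * volume A ^ e)) := by
          rw [lintegral_mul_const _ (by fun_prop)]
  rw [hNeq]
  calc ‖η x‖ₑ = (volume A)⁻¹ * (volume A * ‖η x‖ₑ) := by
        rw [← mul_assoc, ENNReal.inv_mul_cancel hA0 hAt, one_mul]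
    _ ≤ (volume A)⁻¹ * (ENNReal.ofReal (4 * R) * (T * (N * volume A ^ e))) := by gcongr
    _ = _ := by ring

end Morrey

end VarExp

/-! ### The Sobolev modular and the embedding of `V₀^{1,p}` into `L^∞` -/

namespace VarExp

section SobolevModular

variable {n : ℕ} {Ω : Set (EuclideanSpace ℝ (Fin n))} {p : EuclideanSpace ℝ (Fin n) → ℝ} {q : ℝ}
  {u v : EuclideanSpace ℝ (Fin n) → ℝ}
  {G H : EuclideanSpace ℝ (Fin n) → EuclideanSpace ℝ (Fin n)}

theorem gradientModular_eq (hΩ : IsOpen Ω) (h : HasWeakGradient Ω u G) :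
    gradientModular Ω p u = normModular (volume.restrict Ω) p G := by
  rw [← normModular_congr (h.weakGradient_ae_eq hΩ)]
  simp only [gradientModular, modular, normModular, abs_norm]

theorem sobolevModular_eq (hΩ : IsOpen Ω) (h : HasWeakGradient Ω u G) :
    sobolevModular Ω p u
      = normModular (volume.restrict Ω) p u + normModular (volume.restrict Ω) p G := by
  rw [sobolevModular, if_pos ⟨G, h⟩, gradientModular_eq hΩ h]
  rfl

theorem isQuasiConvex_sobolevModular (hΩ : IsOpen Ω)
    (hpm : AEMeasurable p (volume.restrict Ω)) (hp : ∀ᵐ x ∂volume.restrict Ω, 0 ≤ p x) :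
    Modular.IsQuasiConvex (sobolevModular Ω p) := by
  constructor
  · intro c u hc
    by_cases hu : ∃ G, HasWeakGradient Ω u G
    · obtain ⟨G, hG⟩ := hu
      have hle : ∀ {F : Type} [NormedAddCommGroup F] [NormedSpace ℝ F] (z : F),
          ‖c • z‖ ≤ ‖z‖ := fun z => by
        rw [norm_smul]
        exact mul_le_of_le_one_left (norm_nonneg z) hc
      rw [sobolevModular_eq hΩ hG, sobolevModular_eq hΩ (hG.const_smul c)]
      gcongr ?_ + ?_ <;>
      exact normModular_mono hp (Eventually.of_forall fun x => hle _)
    · rw [sobolevModular.eq_1 Ω p u, if_neg hu]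
      exact le_top
  · intro u v
    by_cases hu : ∃ G, HasWeakGradient Ω u G
    · by_cases hv : ∃ G, HasWeakGradient Ω v G
      · obtain ⟨G, hG⟩ := hu
        obtain ⟨H, hH⟩ := hv
        rw [sobolevModular_eq hΩ hG, sobolevModular_eq hΩ hH,
          sobolevModular_eq hΩ ((hG.add hH).const_smul _), add_add_add_comm]
        exact add_le_add (normModular_half_add_le hpm hp hG.1.aestronglyMeasurable v)
          (normModular_half_add_le hpm hp hG.2.1.aestronglyMeasurable H)
      · rw [sobolevModular.eq_1 Ω p v, if_neg hv]
        exact le_top.trans_eq (by simp)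
    · rw [sobolevModular.eq_1 Ω p u, if_neg hu]
      exact le_top.trans_eq (by simp)

theorem exists_hasWeakGradient_of_mem_W1 (hu : u ∈ W1 Ω p) : ∃ G, HasWeakGradient Ω u G := by
  obtain ⟨c, hc, h⟩ := hu
  by_cases hcu : ∃ G, HasWeakGradient Ω (c • u) G
  · obtain ⟨G, hG⟩ := hcu
    refine ⟨c⁻¹ • G, ?_⟩
    simpa only [smul_smul, inv_mul_cancel₀ hc.ne', one_smul] using hG.const_smul c⁻¹
  · rw [sobolevModular, if_neg hcu] at h
    exact absurd h (lt_irrefl _)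

theorem hasWeakGradient_of_mem_W1 (hu : u ∈ W1 Ω p) :
    HasWeakGradient Ω u (weakGradient Ω u) :=
  hasWeakGradient_weakGradient (exists_hasWeakGradient_of_mem_W1 hu)

theorem memLp_weakGradient_of_mem_W1 (hΩ : IsOpen Ω) [IsFiniteMeasure (volume.restrict Ω)]
    (hpm : AEMeasurable p (volume.restrict Ω)) (hq : 0 < q)
    (hp : ∀ᵐ x ∂volume.restrict Ω, q ≤ p x) (hu : u ∈ W1 Ω p) :
    MemLp (weakGradient Ω u) (ENNReal.ofReal q) (volume.restrict Ω) := by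
  have hG := hasWeakGradient_of_mem_W1 hu
  obtain ⟨c, hc, h⟩ := hu
  rw [sobolevModular_eq hΩ (hG.const_smul c)] at h
  have h1 := memLp_of_normModular_lt_top hq hp hpm
    (hG.2.1.aestronglyMeasurable.const_smul c) (le_add_self.trans_lt h)
  simpa only [smul_smul, inv_mul_cancel₀ hc.ne', one_smul] using h1.const_smul c⁻¹

theorem normModular_lt_top_of_norm_le_one {α E : Type*} [MeasurableSpace α]
    [NormedAddCommGroup E] {μ : Measure α} [IsFiniteMeasure μ] {p : α → ℝ}
    (hp : ∀ᵐ x ∂μ, 1 ≤ p x) {f : α → E} (hf : ∀ x, ‖f x‖ ≤ 1) : normModular μ p f < ⊤ := by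
  refine lt_of_le_of_lt (lintegral_mono_ae (g := fun _ => 1) ?_) (by simp)
  filter_upwards [hp] with x hx
  rw [ENNReal.ofReal_le_one, div_le_one (by linarith)]
  exact (Real.rpow_le_one (norm_nonneg _) (hf x) (by linarith)).trans hx

theorem normModular_le_eLpNorm_top {α E : Type*} [MeasurableSpace α]
    [NormedAddCommGroup E] {μ : Measure α} {p : α → ℝ} (hp : ∀ᵐ x ∂μ, 1 ≤ p x) {f : α → E}
    (hf : eLpNorm f ⊤ μ ≤ 1) : normModular μ p f ≤ eLpNorm f ⊤ μ * μ Set.univ := by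
  rw [← lintegral_const]
  refine lintegral_mono_ae ?_
  filter_upwards [hp, ae_le_eLpNormEssSup (f := f) (μ := μ)] with x hx hfx
  rw [eLpNorm_exponent_top] at hf ⊢
  refine le_trans ?_ hfx
  have h1 : ‖f x‖ ≤ 1 := by
    have := hfx.trans hf
    rwa [← ofReal_norm, ENNReal.ofReal_le_one] at this
  rw [← ofReal_norm]
  refine ENNReal.ofReal_le_ofReal ((div_le_self (by positivity) hx).trans ?_)
  simpa using Real.rpow_le_rpow_of_exponent_ge' (norm_nonneg (f x)) h1 zero_le_one hx

theorem add_mem_testFunctions (hu : u ∈ testFunctions Ω) (hv : v ∈ testFunctions Ω) :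
    u + v ∈ testFunctions Ω :=
  ⟨hu.1.add hv.1, hu.2.1.add hv.2.1, (tsupport_add u v).trans (Set.union_subset hu.2.2 hv.2.2)⟩

theorem smul_mem_testFunctions (c : ℝ) (hu : u ∈ testFunctions Ω) : c • u ∈ testFunctions Ω :=
  ⟨contDiff_const.smul hu.1, hu.2.1.smul_left (f := fun _ => c),
    (tsupport_smul_subset_right (fun _ => c) u).trans hu.2.2⟩

theorem zero_mem_testFunctions : (0 : EuclideanSpace ℝ (Fin n) → ℝ) ∈ testFunctions Ω :=
  ⟨contDiff_const, HasCompactSupport.zero, by simp⟩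

theorem testFunctions_subset_W1 (hΩ : IsOpen Ω) [IsFiniteMeasure (volume.restrict Ω)]
    (hp : ∀ᵐ x ∂volume.restrict Ω, 1 ≤ p x) : testFunctions Ω ⊆ W1 Ω p := by
  intro η hη
  obtain ⟨a, ha⟩ := hη.2.1.exists_bound_of_continuous hη.1.continuous
  obtain ⟨b, hb⟩ :=
    (hasCompactSupport_gradient_of_test hη).exists_bound_of_continuous
      (continuous_gradient_of_test hη)
  have hm : 0 < |a| + |b| + 1 := by positivity
  refine ⟨(|a| + |b| + 1)⁻¹, by positivity, ?_⟩
  rw [sobolevModular_eq hΩ ((hasWeakGradient_of_test hη).const_smul _)]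
  refine ENNReal.add_lt_top.2 ⟨normModular_lt_top_of_norm_le_one hp fun x => ?_,
    normModular_lt_top_of_norm_le_one hp fun x => ?_⟩
  · rw [Pi.smul_apply, norm_smul, norm_inv, Real.norm_of_nonneg hm.le, inv_mul_le_one₀ hm]
    linarith [ha x, le_abs_self a, abs_nonneg b]
  · rw [Pi.smul_apply, norm_smul, norm_inv, Real.norm_of_nonneg hm.le, inv_mul_le_one₀ hm]
    linarith [hb x, le_abs_self b, abs_nonneg a]

theorem V10_subset_W1 (hΩ : IsOpen Ω) [IsFiniteMeasure (volume.restrict Ω)]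
    (hp : ∀ᵐ x ∂volume.restrict Ω, 1 ≤ p x) : V10 Ω p ⊆ W1 Ω p :=
  Modular.closure_subset_space (testFunctions_subset_W1 hΩ hp)

theorem add_mem_V10 (hΩ : IsOpen Ω) [IsFiniteMeasure (volume.restrict Ω)]
    (hpm : AEMeasurable p (volume.restrict Ω)) (hp : ∀ᵐ x ∂volume.restrict Ω, 1 ≤ p x)
    (hu : u ∈ V10 Ω p) (hv : v ∈ V10 Ω p) : u + v ∈ V10 Ω p :=
  Modular.add_mem_closure
    (isQuasiConvex_sobolevModular hΩ hpm (hp.mono fun _ hx => zero_le_one.trans hx))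
    (testFunctions_subset_W1 hΩ hp) (fun _ hx _ hy => add_mem_testFunctions hx hy) hu hv

theorem smul_mem_V10 (hΩ : IsOpen Ω) [IsFiniteMeasure (volume.restrict Ω)]
    (hpm : AEMeasurable p (volume.restrict Ω)) (hp : ∀ᵐ x ∂volume.restrict Ω, 1 ≤ p x) (c : ℝ)
    (hu : u ∈ V10 Ω p) : c • u ∈ V10 Ω p :=
  Modular.smul_mem_closure
    (isQuasiConvex_sobolevModular hΩ hpm (hp.mono fun _ hx => zero_le_one.trans hx))
    (testFunctions_subset_W1 hΩ hp) (fun _ hx _ hy => add_mem_testFunctions hx hy)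
    (fun c _ hx => smul_mem_testFunctions c hx) c hu

theorem neg_mem_V10 (hΩ : IsOpen Ω) [IsFiniteMeasure (volume.restrict Ω)]
    (hpm : AEMeasurable p (volume.restrict Ω)) (hp : ∀ᵐ x ∂volume.restrict Ω, 1 ≤ p x)
    (hu : u ∈ V10 Ω p) : -u ∈ V10 Ω p := by
  simpa only [neg_one_smul] using smul_mem_V10 hΩ hpm hp (-1) hu

/-- Morrey's estimate on `V₀^{1,p}(Ω)`. The functions that satisfy it form a modularly closed set,
because modular convergence implies `L^q` convergence of the functions and their gradients. -/
theorem exists_eLpNorm_top_le (hn : 1 ≤ n) (hΩ : IsOpen Ω) (hΩb : Bornology.IsBounded Ω)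
    [IsFiniteMeasure (volume.restrict Ω)] (hpm : AEMeasurable p (volume.restrict Ω))
    (hq : (n : ℝ) < q) (hp : ∀ᵐ x ∂volume.restrict Ω, q ≤ p x) :
    ∃ C : ℝ≥0∞, C ≠ ⊤ ∧ ∀ w ∈ V10 Ω p, eLpNorm w ⊤ (volume.restrict Ω)
      ≤ C * eLpNorm (weakGradient Ω w) (ENNReal.ofReal q) (volume.restrict Ω) := by
  obtain ⟨C, hC, H⟩ := exists_enorm_le_eLpNorm_gradient hn hΩb hq
  have hn1 : (1 : ℝ) ≤ n := by exact_mod_cast hn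
  have hq0 : 0 < q := by linarith
  have hp0 : ∀ᵐ x ∂volume.restrict Ω, 0 < p x := hp.mono fun x hx => by linarith
  refine ⟨C, hC, fun w hw => (Modular.closure_subset (B := {w | w ∈ W1 Ω p ∧
    eLpNorm w ⊤ (volume.restrict Ω) ≤
      C * eLpNorm (weakGradient Ω w) (ENNReal.ofReal q) (volume.restrict Ω)})
    ⟨fun w hw => hw.1, fun w a ha hw hlim => ⟨ha, ?_⟩⟩ (fun η hη => ⟨?_, ?_⟩) hw).2⟩
  · have hga := hasWeakGradient_of_mem_W1 ha
    have hgw := fun k => hasWeakGradient_of_mem_W1 (hw k).1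
    have hsub : ∀ k, sobolevModular Ω p (w k - a)
        = normModular (volume.restrict Ω) p (w k - a)
          + normModular (volume.restrict Ω) p (weakGradient Ω (w k) - weakGradient Ω a) :=
      fun k => sobolevModular_eq hΩ ((hgw k).sub hga)
    simp only [hsub] at hlim
    have hl1 : Tendsto (fun k => normModular (volume.restrict Ω) p (w k - a)) atTop (𝓝 0) :=
      tendsto_of_tendsto_of_tendsto_of_le_of_le tendsto_const_nhds hlim (fun _ => zero_le)
        fun k => le_self_add
    have hl2 : Tendsto (fun k => normModular (volume.restrict Ω) p
        (weakGradient Ω (w k) - weakGradient Ω a)) atTop (𝓝 0) :=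
      tendsto_of_tendsto_of_tendsto_of_le_of_le tendsto_const_nhds hlim (fun _ => zero_le)
        fun k => le_add_self
    obtain ⟨ns, hns, hae⟩ := exists_subseq_tendsto_zero_ae hpm hp0
      (fun k => (hgw k).1.aestronglyMeasurable.sub hga.1.aestronglyMeasurable) hl1
    have hlq := tendsto_eLpNorm_of_normModular hq0 hp hpm
      (fun k => (hgw k).2.1.aestronglyMeasurable.sub hga.2.1.aestronglyMeasurable) hl2
    have hae' : ∀ᵐ x ∂volume.restrict Ω, Tendsto (fun k => w (ns k) x) atTop (𝓝 (a x)) := by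
      filter_upwards [hae] with x hx
      simpa using hx.add_const (a x)
    refine (Lp.eLpNorm_lim_le_liminf_eLpNorm
      (fun k => (hgw (ns k)).1.aestronglyMeasurable) a hae').trans ?_
    have hbound : ∀ k, eLpNorm (w (ns k)) ⊤ (volume.restrict Ω) ≤
        C * (eLpNorm (weakGradient Ω (w (ns k)) - weakGradient Ω a) (ENNReal.ofReal q)
            (volume.restrict Ω)
          + eLpNorm (weakGradient Ω a) (ENNReal.ofReal q) (volume.restrict Ω)) := by
      intro k
      refine (hw (ns k)).2.trans ?_
      gcongr
      have h1 := eLpNorm_add_le (p := ENNReal.ofReal q)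
        ((hgw (ns k)).2.1.aestronglyMeasurable.sub hga.2.1.aestronglyMeasurable)
        hga.2.1.aestronglyMeasurable (ENNReal.one_le_ofReal.2 (by linarith))
      rwa [sub_add_cancel] at h1
    have hlim2 := ENNReal.Tendsto.const_mul (a := C)
      ((hlq.comp hns.tendsto_atTop).add_const
        (eLpNorm (weakGradient Ω a) (ENNReal.ofReal q) (volume.restrict Ω))) (Or.inr hC)
    rw [zero_add] at hlim2
    exact (liminf_le_liminf (Eventually.of_forall hbound)).trans_eq hlim2.liminf_eq
  · exact testFunctions_subset_W1 hΩ (hp.mono fun x hx => by linarith) hη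
  · rw [eLpNorm_congr_ae ((hasWeakGradient_of_test hη).weakGradient_ae_eq hΩ),
      eLpNorm_exponent_top]
    exact eLpNormEssSup_le_of_ae_enorm_bound (Eventually.of_forall (H η hη))

end SobolevModular

end VarExp

/-! ### Existence of a minimizer -/

namespace VarExp

theorem exists_memLp_tendsto_of_cauchy {α E : Type*} [MeasurableSpace α] [NormedAddCommGroup E]
    [CompleteSpace E] {μ : Measure α} {r : ℝ≥0∞} (hr : 1 ≤ r) {f : ℕ → α → E}
    (hf : ∀ k, MemLp (f k) r μ)
    (h : Tendsto (fun z : ℕ × ℕ => eLpNorm (f z.1 - f z.2) r μ) atTop (𝓝 0)) :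
    ∃ g, MemLp g r μ ∧ Tendsto (fun k => eLpNorm (f k - g) r μ) atTop (𝓝 0) := by
  have : Fact (1 ≤ r) := ⟨hr⟩
  have hc : CauchySeq fun k => (hf k).toLp (f k) := by
    rw [cauchySeq_iff_tendsto_dist_atTop_0]
    have := (ENNReal.tendsto_toReal ENNReal.zero_ne_top).comp h
    rw [ENNReal.toReal_zero] at this
    refine this.congr fun z => ?_
    rw [Function.comp_apply, dist_edist, Lp.edist_toLp_toLp]
  obtain ⟨g, hg⟩ := cauchySeq_tendsto_of_complete hc
  refine ⟨g, Lp.memLp g, ?_⟩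
  rw [Lp.tendsto_Lp_iff_tendsto_eLpNorm'] at hg
  refine hg.congr fun k => eLpNorm_congr_ae ?_
  filter_upwards [(hf k).coeFn_toLp] with x hx
  simp [hx]

theorem tendsto_eLpNorm_one {α E : Type*} [MeasurableSpace α] [NormedAddCommGroup E]
    {μ : Measure α} [IsFiniteMeasure μ] {r : ℝ≥0∞} (hr : 1 ≤ r) {f : ℕ → α → E}
    (hf : ∀ k, AEStronglyMeasurable (f k) μ)
    (h : Tendsto (fun k => eLpNorm (f k) r μ) atTop (𝓝 0)) :
    Tendsto (fun k => eLpNorm (f k) 1 μ) atTop (𝓝 0) := by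
  have hexp : 0 ≤ 1 / (1 : ℝ≥0∞).toReal - 1 / r.toReal := by
    rw [ENNReal.toReal_one, div_one, sub_nonneg]
    rcases eq_or_ne r ⊤ with rfl | hr'
    · simp
    · have : 1 ≤ r.toReal := by
        rw [← ENNReal.toReal_one]; exact ENNReal.toReal_mono hr' hr
      exact (div_le_one (by linarith)).2 this
  have h1 := ENNReal.Tendsto.mul_const (b := μ Set.univ ^ (1 / (1 : ℝ≥0∞).toReal - 1 / r.toReal))
    h (Or.inr (ENNReal.rpow_ne_top_of_nonneg hexp (measure_ne_top _ _)))
  rw [zero_mul] at h1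
  exact tendsto_of_tendsto_of_tendsto_of_le_of_le tendsto_const_nhds h1 (fun _ => zero_le)
    fun k => eLpNorm_le_eLpNorm_mul_rpow_measure_univ hr (hf k)

section Minimizer

variable {n : ℕ} {Ω : Set (EuclideanSpace ℝ (Fin n))} {p : EuclideanSpace ℝ (Fin n) → ℝ} {q : ℝ}
  {φ : EuclideanSpace ℝ (Fin n) → ℝ}

/-- If the gradients of a sequence in `V₀^{1,p}(Ω)` are Cauchy with respect to the modular of half
the difference, the sequence converges to an element of `V₀^{1,p}(Ω)`, with gradients converging
almost everywhere along a subsequence. -/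
theorem exists_mem_V10_of_cauchy (hn : 1 ≤ n) (hΩ : IsOpen Ω) (hΩb : Bornology.IsBounded Ω)
    [IsFiniteMeasure (volume.restrict Ω)] (hpm : AEMeasurable p (volume.restrict Ω))
    (hq : (n : ℝ) < q) (hp : ∀ᵐ x ∂volume.restrict Ω, q ≤ p x)
    {v : ℕ → EuclideanSpace ℝ (Fin n) → ℝ} (hv : ∀ k, v k ∈ V10 Ω p)
    (hcauchy : Tendsto (fun z : ℕ × ℕ => normModular (volume.restrict Ω) p
      ((1 / 2 : ℝ) • (weakGradient Ω (v z.1) - weakGradient Ω (v z.2)))) atTop (𝓝 0)) :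
    ∃ w ∈ V10 Ω p, ∃ G, HasWeakGradient Ω w G ∧ ∃ ns : ℕ → ℕ, StrictMono ns ∧
      ∀ᵐ x ∂volume.restrict Ω,
        Tendsto (fun k => weakGradient Ω (v (ns k)) x) atTop (𝓝 (G x)) := by
  set μ := volume.restrict Ω with hμ
  have hn1 : (1 : ℝ) ≤ n := by exact_mod_cast hn
  have hq1 : 1 < q := by linarith
  have hq0 : 0 < q := by linarith
  have hp0 : ∀ᵐ x ∂μ, 0 < p x := hp.mono fun x hx => by linarith
  have hp1 : ∀ᵐ x ∂μ, 1 ≤ p x := hp.mono fun x hx => by linarith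
  have hρ : Modular.IsQuasiConvex (sobolevModular Ω p) :=
    isQuasiConvex_sobolevModular hΩ hpm (hp0.mono fun x hx => hx.le)
  have htest : testFunctions Ω ⊆ W1 Ω p := testFunctions_subset_W1 hΩ hp1
  have hVW : V10 Ω p ⊆ W1 Ω p := V10_subset_W1 hΩ hp1
  have hg : ∀ k, HasWeakGradient Ω (v k) (weakGradient Ω (v k)) := fun k =>
    hasWeakGradient_of_mem_W1 (hVW (hv k))
  have hgm : ∀ k, AEStronglyMeasurable (weakGradient Ω (v k)) μ := fun k =>
    (hg k).2.1.aestronglyMeasurable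
  obtain ⟨C, hC, hMorrey⟩ := exists_eLpNorm_top_le hn hΩ hΩb hpm hq hp
  have hqE : 1 ≤ ENNReal.ofReal q := ENNReal.one_le_ofReal.2 hq1.le
  have hLq : ∀ k, MemLp (weakGradient Ω (v k)) (ENNReal.ofReal q) μ := fun k =>
    memLp_weakGradient_of_mem_W1 hΩ hpm hq0 hp (hVW (hv k))
  have hLtop : ∀ k, MemLp (v k) ⊤ μ := fun k => ⟨(hg k).1.aestronglyMeasurable,
    (hMorrey _ (hv k)).trans_lt (ENNReal.mul_lt_top hC.lt_top (hLq k).2)⟩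
  have hCq : Tendsto (fun z : ℕ × ℕ => eLpNorm (weakGradient Ω (v z.1) - weakGradient Ω (v z.2))
      (ENNReal.ofReal q) μ) atTop (𝓝 0) := by
    have h1 := tendsto_eLpNorm_of_normModular hq0 hp hpm
      (fun z : ℕ × ℕ => ((hgm z.1).sub (hgm z.2)).const_smul (1 / 2 : ℝ)) hcauchy
    have h2 := ENNReal.Tendsto.const_mul (a := ‖(2 : ℝ)‖ₑ) h1 (Or.inr enorm_ne_top)
    rw [mul_zero] at h2
    refine h2.congr fun z => ?_
    rw [← eLpNorm_const_smul, smul_smul]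
    norm_num
  have hCtop : Tendsto (fun z : ℕ × ℕ => eLpNorm (v z.1 - v z.2) ⊤ μ) atTop (𝓝 0) := by
    have h2 := ENNReal.Tendsto.const_mul (a := C) hCq (Or.inr hC)
    rw [mul_zero] at h2
    refine tendsto_of_tendsto_of_tendsto_of_le_of_le tendsto_const_nhds h2 (fun _ => zero_le)
      fun z => ?_
    have h3 : v z.1 - v z.2 ∈ V10 Ω p := by
      rw [sub_eq_add_neg]
      exact add_mem_V10 hΩ hpm hp1 (hv _) (neg_mem_V10 hΩ hpm hp1 (hv _))
    refine (hMorrey _ h3).trans_eq ?_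
    rw [eLpNorm_congr_ae (((hg z.1).sub (hg z.2)).weakGradient_ae_eq hΩ)]
  obtain ⟨G, hGm, hG⟩ := exists_memLp_tendsto_of_cauchy hqE hLq hCq
  obtain ⟨w, hwm, hw⟩ := exists_memLp_tendsto_of_cauchy le_top hLtop hCtop
  have hwG : HasWeakGradient Ω w G := by
    refine HasWeakGradient.of_tendsto hg (hwm.integrable le_top) (hGm.integrable hqE) ?_ ?_
    · exact tendsto_eLpNorm_one le_top (fun k => ((hLtop k).1.sub hwm.1)) hw
    · exact tendsto_eLpNorm_one hqE (fun k => ((hLq k).1.sub hGm.1)) hG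
  obtain ⟨ns, hns, hae⟩ := (tendstoInMeasure_of_tendsto_eLpNorm
    (by simpa using hq0) hgm hGm.1 hG).exists_seq_tendsto_ae
  have hhalf : ∀ k, sobolevModular Ω p ((1 / 2 : ℝ) • v k - (1 / 2 : ℝ) • w)
      = normModular μ p ((1 / 2 : ℝ) • (v k - w))
        + normModular μ p ((1 / 2 : ℝ) • (weakGradient Ω (v k) - G)) := fun k => by
    rw [← smul_sub]
    exact sobolevModular_eq hΩ (((hg k).sub hwG).const_smul _)
  have hlim1 : Tendsto (fun k => normModular μ p ((1 / 2 : ℝ) • (v k - w))) atTop (𝓝 0) := by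
    have h1 := ENNReal.Tendsto.mul_const (b := μ Set.univ) hw (Or.inr (measure_ne_top _ _))
    rw [zero_mul] at h1
    refine tendsto_of_tendsto_of_tendsto_of_le_of_le' tendsto_const_nhds h1
      (Eventually.of_forall fun _ => zero_le) ?_
    filter_upwards [hw.eventually_le_const one_pos] with k hk
    refine le_trans (normModular_mono (hp0.mono fun x hx => hx.le)
      (Eventually.of_forall fun x => ?_)) (normModular_le_eLpNorm_top hp1 hk)
    rw [Pi.smul_apply, norm_smul]
    exact mul_le_of_le_one_left (norm_nonneg _) (by norm_num)
  -- Lower semicontinuity turns the Cauchy property into convergence to the limit.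
  have hlim2 : Tendsto (fun k => normModular μ p ((1 / 2 : ℝ) • (weakGradient Ω (v k) - G))) atTop
      (𝓝 0) := by
    rw [ENNReal.tendsto_nhds_zero] at hcauchy ⊢
    intro ε hε
    have h1 := hcauchy ε hε
    rw [← prod_atTop_atTop_eq] at h1
    filter_upwards [h1.curry] with j hj
    refine (normModular_le_liminf hpm hp0
      (fun k => ((hgm j).sub (hgm (ns k))).const_smul (1 / 2 : ℝ)) ?_).trans
      (liminf_le_of_frequently_le' ((hns.tendsto_atTop.eventually hj).frequently))
    filter_upwards [hae] with x hx
    exact (hx.const_sub _).const_smul (1 / 2 : ℝ)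
  have hlim : Tendsto (fun k => sobolevModular Ω p ((1 / 2 : ℝ) • v k - (1 / 2 : ℝ) • w)) atTop
      (𝓝 0) := by
    simp only [hhalf]
    simpa using hlim1.add hlim2
  have hwW : (1 / 2 : ℝ) • w ∈ W1 Ω p := by
    obtain ⟨k, hk⟩ := (hlim.eventually_lt_const ENNReal.zero_lt_top).exists
    have h1 : (1 / 2 : ℝ) • v k - (1 / 2 : ℝ) • w ∈ W1 Ω p := ⟨1, one_pos, by rwa [one_smul]⟩
    have h2 := Modular.add_mem_space hρ (hVW (smul_mem_V10 hΩ hpm hp1 (1 / 2) (hv k)))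
      (Modular.smul_mem_space hρ h1 (-1))
    rwa [neg_one_smul, neg_sub, add_sub_cancel] at h2
  have hwV : (1 / 2 : ℝ) • w ∈ V10 Ω p :=
    (Modular.isClosed_closure htest).2 _ _ hwW (fun k => smul_mem_V10 hΩ hpm hp1 _ (hv k)) hlim
  refine ⟨w, ?_, G, hwG, ns, hns, hae⟩
  have := smul_mem_V10 hΩ hpm hp1 2 hwV
  rwa [smul_smul, show (2 : ℝ) * (1 / 2) = 1 by norm_num, one_smul] at this

/-- The Dirichlet energy attains its minimum over `V₀^{1,p}(Ω)`. -/
theorem exists_minimizer (hn : 1 ≤ n) (hΩ : IsOpen Ω) (hΩb : Bornology.IsBounded Ω)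
    [IsFiniteMeasure (volume.restrict Ω)] (hpm : AEMeasurable p (volume.restrict Ω))
    (hq : (n : ℝ) < q) (hp : ∀ᵐ x ∂volume.restrict Ω, q ≤ p x)
    (hφ : φ ∈ W1 Ω p) (hφg : gradientModular Ω p φ < ⊤) :
    ∃ v ∈ V10 Ω p, gradientModular Ω p (v - φ) < ⊤ ∧
      ∀ w ∈ V10 Ω p, gradientModular Ω p (v - φ) ≤ gradientModular Ω p (w - φ) := by
  set μ := volume.restrict Ω with hμ
  have hn1 : (1 : ℝ) ≤ n := by exact_mod_cast hn
  have hp0 : ∀ᵐ x ∂μ, 0 < p x := hp.mono fun x hx => by linarith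
  have hp1 : ∀ᵐ x ∂μ, 1 ≤ p x := hp.mono fun x hx => by linarith
  have hgφ := hasWeakGradient_of_mem_W1 hφ
  have hgV : ∀ {w}, w ∈ V10 Ω p → HasWeakGradient Ω w (weakGradient Ω w) := fun hw =>
    hasWeakGradient_of_mem_W1 (V10_subset_W1 hΩ hp1 hw)
  have henergy : ∀ {w}, w ∈ V10 Ω p → gradientModular Ω p (w - φ)
      = normModular μ p (weakGradient Ω w - weakGradient Ω φ) := fun hw =>
    gradientModular_eq hΩ ((hgV hw).sub hgφ)
  set S : Set ℝ≥0∞ := (fun w => gradientModular Ω p (w - φ)) '' V10 Ω p with hS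
  have h0V : (0 : EuclideanSpace ℝ (Fin n) → ℝ) ∈ V10 Ω p :=
    Modular.subset_closure zero_mem_testFunctions
  have hSne : S.Nonempty := ⟨_, Set.mem_image_of_mem _ h0V⟩
  have hI : sInf S < ⊤ := by
    refine (sInf_le (Set.mem_image_of_mem _ h0V)).trans_lt ?_
    have h1 : HasWeakGradient Ω (0 - φ) ((-1 : ℝ) • weakGradient Ω φ) := by
      rw [zero_sub, ← neg_one_smul ℝ φ]
      exact hgφ.const_smul _
    rw [gradientModular_eq hΩ h1]
    refine lt_of_le_of_lt (normModular_mono (hp0.mono fun x hx => hx.le)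
      (Eventually.of_forall fun x => ?_)) ((gradientModular_eq hΩ hgφ).symm.trans_lt hφg)
    simp
  obtain ⟨s, -, hs, hsS⟩ := exists_seq_tendsto_sInf hSne (OrderBot.bddBelow S)
  choose v hv hvs using hsS
  have hlim : Tendsto (fun k => normModular μ p (weakGradient Ω (v k) - weakGradient Ω φ)) atTop
      (𝓝 (sInf S)) :=
    hs.congr fun k => by rw [← hvs k]; exact henergy (hv k)
  have hmeas : ∀ k, AEStronglyMeasurable (weakGradient Ω (v k) - weakGradient Ω φ) μ := fun k =>
    (hgV (hv k)).2.1.aestronglyMeasurable.sub hgφ.2.1.aestronglyMeasurable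
  have hcauchy := tendsto_normModular_half_sub (by linarith : 1 < q) hp hpm hmeas hI.ne hlim
    fun j k => by
      have hmid : (1 / 2 : ℝ) • (v j + v k) ∈ V10 Ω p :=
        smul_mem_V10 hΩ hpm hp1 _ (add_mem_V10 hΩ hpm hp1 (hv j) (hv k))
      refine (sInf_le (Set.mem_image_of_mem _ hmid)).trans_eq ?_
      have h1 := (((hgV (hv j)).add (hgV (hv k))).const_smul (1 / 2 : ℝ)).sub hgφ
      show gradientModular Ω p _ = _
      rw [gradientModular_eq hΩ h1]
      congr 1
      module
  simp only [sub_sub_sub_cancel_right] at hcauchy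
  obtain ⟨w, hw, G, hG, ns, hns, hae⟩ := exists_mem_V10_of_cauchy hn hΩ hΩb hpm hq hp hv hcauchy
  have hle : gradientModular Ω p (w - φ) ≤ sInf S := by
    rw [gradientModular_eq hΩ (hG.sub hgφ), ← (hlim.comp hns.tendsto_atTop).liminf_eq]
    refine normModular_le_liminf hpm hp0 (fun k => hmeas (ns k)) ?_
    filter_upwards [hae] with x hx
    exact hx.sub_const _
  exact ⟨w, hw, hle.trans_lt hI, fun z hz => hle.trans (sInf_le (Set.mem_image_of_mem _ hz))⟩

end Minimizer

end VarExp

/-! ### The Euler-Lagrange equation -/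

namespace VarExp

section EulerLagrange

variable {α E : Type*} [MeasurableSpace α] [NormedAddCommGroup E] {μ : Measure α} {p : α → ℝ}

theorem norm_rpow_sub_two_smul [NormedSpace ℝ E] {r : ℝ} (hr : 1 < r) (a : E) :
    ‖‖a‖ ^ (r - 2) • a‖ = ‖a‖ ^ (r - 1) := by
  rcases eq_or_ne a 0 with rfl | ha
  · simp [Real.zero_rpow (by linarith : r - 1 ≠ 0)]
  · rw [norm_smul, Real.norm_of_nonneg (by positivity),
      ← Real.rpow_add_one (norm_ne_zero_iff.2 ha)]
    congr 1
    ring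

theorem integrable_norm_rpow_div (hpm : AEMeasurable p μ) (hp : ∀ᵐ x ∂μ, 0 ≤ p x) {f : α → E}
    (hf : AEStronglyMeasurable f μ) (h : normModular μ p f < ⊤) :
    Integrable (fun x => ‖f x‖ ^ p x / p x) μ := by
  refine ⟨((hf.norm.aemeasurable.pow hpm).div hpm).aestronglyMeasurable, ?_⟩
  refine lt_of_eq_of_lt (lintegral_congr_ae ?_) h
  filter_upwards [hp] with x hx
  exact Real.enorm_of_nonneg (by positivity)

theorem hasDerivAt_norm_add_smul_rpow_div [InnerProductSpace ℝ E] {r : ℝ} (hr : 1 < r) (a b : E)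
    (t : ℝ) :
    HasDerivAt (fun t : ℝ => ‖a + t • b‖ ^ r / r)
      (inner ℝ (‖a + t • b‖ ^ (r - 2) • (a + t • b)) b) t := by
  have h1 : HasDerivAt (fun t : ℝ => a + t • b) b t := by
    simpa using ((hasDerivAt_id t).smul_const b).const_add a
  have h2 := ((hasFDerivAt_norm_rpow (a + t • b) hr).comp_hasDerivAt t h1).div_const r
  refine h2.congr_deriv ?_
  simp only [_root_.smul_apply, innerSL_apply_apply, smul_eq_mul,
    real_inner_smul_left]
  field_simp

/-- A common bound for the energy density and its derivative along a segment, in terms of the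
energy density at one end. -/
theorem norm_add_smul_rpow_le [NormedSpace ℝ E] {r M L t s : ℝ} (hr : 1 ≤ r) (hM : r ≤ M)
    (hL : 1 ≤ L) {a b : E} (hb : ‖b‖ ≤ L) (ht : |t| ≤ 1) (hs : 0 ≤ s) (hsr : s ≤ r) :
    ‖a + t • b‖ ^ s ≤ 2 ^ M * (M * (‖a‖ ^ r / r) + L ^ M) := by
  have hr0 : 0 < r := by linarith
  have hm : ‖a + t • b‖ ≤ ‖a‖ + L := by
    refine (norm_add_le _ _).trans ?_
    rw [norm_smul, Real.norm_eq_abs]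
    gcongr
    exact (mul_le_of_le_one_left (norm_nonneg _) ht).trans hb
  have ha : ‖a‖ ^ r ≤ M * (‖a‖ ^ r / r) := by
    rw [← mul_div_assoc, le_div_iff₀ hr0, mul_comm]
    gcongr
  have hLr : L ^ r ≤ L ^ M := Real.rpow_le_rpow_of_exponent_le hL hM
  calc ‖a + t • b‖ ^ s ≤ (‖a‖ + L) ^ s := Real.rpow_le_rpow (norm_nonneg _) hm hs
    _ ≤ (‖a‖ + L) ^ r := Real.rpow_le_rpow_of_exponent_le (by linarith [norm_nonneg a]) hsr
    _ ≤ (2 * max ‖a‖ L) ^ r := by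
        refine Real.rpow_le_rpow (by positivity) ?_ hr0.le
        linarith [le_max_left ‖a‖ L, le_max_right ‖a‖ L]
    _ = 2 ^ r * (max ‖a‖ L) ^ r := Real.mul_rpow two_pos.le (by positivity)
    _ ≤ 2 ^ M * (‖a‖ ^ r + L ^ r) := by
        refine mul_le_mul (Real.rpow_le_rpow_of_exponent_le one_le_two hM) ?_ (by positivity)
          (by positivity)
        rcases le_total ‖a‖ L with h | h
        · rw [max_eq_right h]
          exact le_add_of_nonneg_left (by positivity)
        · rw [max_eq_left h]
          exact le_add_of_nonneg_right (by positivity)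
    _ ≤ 2 ^ M * (M * (‖a‖ ^ r / r) + L ^ M) := by gcongr

/-- First variation: if the modular of `f + t b` is smallest at `t = 0`, its derivative there
vanishes. The variation `b` is bounded and lives where `p` is bounded, so the differentiation under
the integral sign is dominated. -/
theorem integral_inner_rpow_smul_eq_zero [InnerProductSpace ℝ E] [IsFiniteMeasure μ]
    (hpm : AEMeasurable p μ) (hp : ∀ᵐ x ∂μ, 1 < p x) {f b : α → E}
    (hf : AEStronglyMeasurable f μ) (hb : AEStronglyMeasurable b μ) {M L : ℝ} (hL : 1 ≤ L)
    (hM : 0 ≤ M) (hbL : ∀ᵐ x ∂μ, b x = 0 ∨ p x ≤ M ∧ ‖b x‖ ≤ L) (hfin : normModular μ p f < ⊤)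
    (hmin : ∀ t : ℝ, normModular μ p f ≤ normModular μ p (f + t • b)) :
    ∫ x, inner ℝ (‖f x‖ ^ (p x - 2) • f x) (b x) ∂μ = 0 := by
  have hp0 : ∀ᵐ x ∂μ, 0 ≤ p x := hp.mono fun x hx => by linarith
  let F : ℝ → α → ℝ := fun t x => ‖f x + t • b x‖ ^ p x / p x
  let F' : ℝ → α → ℝ := fun t x =>
    inner ℝ (‖f x + t • b x‖ ^ (p x - 2) • (f x + t • b x)) (b x)
  let B : α → ℝ := fun x => 2 ^ M * (M * (‖f x‖ ^ p x / p x) + L ^ M)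
  have hf0 : Integrable (fun x => ‖f x‖ ^ p x / p x) μ :=
    integrable_norm_rpow_div hpm hp0 hf hfin
  have hB : Integrable B μ := ((hf0.const_mul M).add (integrable_const _)).const_mul _
  have hmeas : ∀ t : ℝ, AEStronglyMeasurable (fun x => f x + t • b x) μ := fun t =>
    hf.add (hb.const_smul t)
  have hFmeas : ∀ t : ℝ, AEStronglyMeasurable (F t) μ := fun t =>
    (((hmeas t).norm.aemeasurable.pow hpm).div hpm).aestronglyMeasurable
  have hFint : ∀ t : ℝ, |t| ≤ 1 → Integrable (F t) μ := by
    intro t ht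
    refine (hB.add hf0).mono' (hFmeas t) ?_
    filter_upwards [hp, hbL] with x hx hbx
    have hB0 : 0 ≤ B x := by positivity
    have hf00 : 0 ≤ ‖f x‖ ^ p x / p x := by positivity
    rw [Real.norm_of_nonneg (by positivity), Pi.add_apply]
    rcases hbx with h0 | ⟨h1, h2⟩
    · simp only [F, h0, smul_zero, add_zero]
      linarith
    · have h3 : F t x ≤ ‖f x + t • b x‖ ^ p x := div_le_self (by positivity) hx.le
      have h4 := norm_add_smul_rpow_le hx.le h1 hL h2 ht (by linarith) le_rfl (a := f x)
      linarith
  have hF'meas : AEStronglyMeasurable (F' 0) μ := by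
    refine AEStronglyMeasurable.inner ?_ hb
    exact (((hmeas 0).norm.aemeasurable.pow (hpm.sub_const 2)).aestronglyMeasurable).smul (hmeas 0)
  have hbound : ∀ᵐ x ∂μ, ∀ t ∈ Metric.ball (0 : ℝ) 1, ‖F' t x‖ ≤ B x * L := by
    filter_upwards [hp, hbL] with x hx hbx t ht
    have hB0 : 0 ≤ B x := by positivity
    rcases hbx with h0 | ⟨h1, h2⟩
    · simp only [F', h0, inner_zero_right, norm_zero]
      positivity
    · refine (norm_inner_le_norm _ _).trans ?_
      rw [norm_rpow_sub_two_smul hx]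
      gcongr
      rw [mem_ball_zero_iff, Real.norm_eq_abs] at ht
      exact norm_add_smul_rpow_le hx.le h1 hL h2 ht.le (by linarith) (by linarith)
  have hderiv := (hasDerivAt_integral_of_dominated_loc_of_deriv_le
    (Metric.ball_mem_nhds (0 : ℝ) one_pos) (Eventually.of_forall hFmeas)
    (hFint 0 (by simp)) hF'meas hbound (hB.mul_const L) (by
      filter_upwards [hp] with x hx t _
      exact hasDerivAt_norm_add_smul_rpow_div hx (f x) (b x) t)).2
  have hJ : ∀ t : ℝ, |t| ≤ 1 → ENNReal.ofReal (∫ x, F t x ∂μ) = normModular μ p (f + t • b) :=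
    fun t ht => ofReal_integral_eq_lintegral_ofReal (hFint t ht)
      (hp0.mono fun x hx => by positivity)
  have hlocmin : IsLocalMin (fun t => ∫ x, F t x ∂μ) 0 := by
    filter_upwards [Metric.ball_mem_nhds (0 : ℝ) one_pos] with t ht
    rw [mem_ball_zero_iff, Real.norm_eq_abs] at ht
    have hnn : 0 ≤ ∫ x, F t x ∂μ :=
      integral_nonneg_of_ae (hp0.mono fun x hx => by positivity)
    rw [← ENNReal.ofReal_le_ofReal_iff hnn, hJ t ht.le, hJ 0 (by simp), zero_smul, add_zero]
    exact hmin t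
  have := hlocmin.hasDerivAt_eq_zero hderiv
  simpa only [F', zero_smul, add_zero] using this

end EulerLagrange

section WeakSolution

variable {n : ℕ} {Ω : Set (EuclideanSpace ℝ (Fin n))} {p : EuclideanSpace ℝ (Fin n) → ℝ}
  {u : EuclideanSpace ℝ (Fin n) → ℝ}

theorem locallyIntegrableOn_flux (hΩ : IsOpen Ω) [IsFiniteMeasure (volume.restrict Ω)]
    (hpc : ContinuousOn p Ω) (hp : ∀ x ∈ Ω, 1 < p x) (hu : HasWeakGradient Ω u (weakGradient Ω u))
    (hfin : gradientModular Ω p u < ⊤) : LocallyIntegrableOn (flux Ω p u) Ω := by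
  have hpm : AEMeasurable p (volume.restrict Ω) := hpc.aemeasurable hΩ.measurableSet
  have hp' : ∀ᵐ x ∂volume.restrict Ω, 0 ≤ p x :=
    ae_restrict_of_forall_mem hΩ.measurableSet fun x hx => by linarith [hp x hx]
  have hGm := hu.2.1.aestronglyMeasurable
  rw [gradientModular_eq hΩ hu] at hfin
  have hint := integrable_norm_rpow_div hpm hp' hGm hfin
  rw [locallyIntegrableOn_iff hΩ.isLocallyClosed]
  intro k hkΩ hk
  obtain ⟨M, hM⟩ := hk.bddAbove_image (hpc.mono hkΩ)
  have hint' : IntegrableOn (fun x => ‖weakGradient Ω u x‖ ^ p x / p x) k :=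
    IntegrableOn.mono_set hint hkΩ
  have hbound : IntegrableOn (fun x => 1 + M * (‖weakGradient Ω u x‖ ^ p x / p x)) k :=
    (integrableOn_const hk.measure_lt_top.ne).add (hint'.const_mul M)
  refine hbound.mono' ?_ (ae_restrict_of_forall_mem hk.measurableSet fun x hx => ?_)
  · have h1 : AEStronglyMeasurable (flux Ω p u) (volume.restrict Ω) :=
      ((hGm.norm.aemeasurable.pow (hpm.sub_const 2)).aestronglyMeasurable).smul hGm
    exact h1.mono_measure (Measure.restrict_mono hkΩ le_rfl)
  · have hx1 := hp x (hkΩ hx)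
    have hx0 : 0 < p x := by linarith
    have hxM : p x ≤ M := hM (Set.mem_image_of_mem p hx)
    rw [flux, norm_rpow_sub_two_smul hx1]
    set g := ‖weakGradient Ω u x‖ with hg
    have hg0 : 0 ≤ g := norm_nonneg _
    have h2 : g ^ p x ≤ M * (g ^ p x / p x) := by
      rw [← mul_div_assoc, le_div_iff₀ hx0, mul_comm]
      gcongr
    rcases le_total g 1 with h | h
    · have h3 : g ^ (p x - 1) ≤ 1 := Real.rpow_le_one hg0 h (by linarith)
      have h4 : 0 ≤ g ^ p x := by positivity
      linarith
    · have h3 : g ^ (p x - 1) ≤ g ^ p x := Real.rpow_le_rpow_of_exponent_le h (by linarith)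
      linarith

theorem isWeakSolution_of_isMin (hΩ : IsOpen Ω) [IsFiniteMeasure (volume.restrict Ω)]
    (hpc : ContinuousOn p Ω) (hp : ∀ x ∈ Ω, 1 < p x) (hu : HasWeakGradient Ω u (weakGradient Ω u))
    (hfin : gradientModular Ω p u < ⊤)
    (hmin : ∀ η ∈ testFunctions Ω, gradientModular Ω p u ≤ gradientModular Ω p (u + η)) :
    IsWeakSolution Ω p u := by
  refine ⟨⟨_, hu⟩, locallyIntegrableOn_flux hΩ hpc hp hu hfin, fun η hη => ?_⟩
  have hp' : ∀ᵐ x ∂volume.restrict Ω, 1 < p x :=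
    ae_restrict_of_forall_mem hΩ.measurableSet hp
  obtain ⟨M, hM⟩ := hη.2.1.bddAbove_image (hpc.mono hη.2.2)
  obtain ⟨L, hL⟩ := (hasCompactSupport_gradient_of_test hη).exists_bound_of_continuous
    (continuous_gradient_of_test hη)
  refine integral_inner_rpow_smul_eq_zero (hpc.aemeasurable hΩ.measurableSet) hp'
    hu.2.1.aestronglyMeasurable (continuous_gradient_of_test hη).aestronglyMeasurable
    (M := max M 0) (L := max L 1) (le_max_right _ _) (le_max_right _ _)
    (Eventually.of_forall fun x => ?_) ?_ fun t => ?_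
  · by_cases hx : x ∈ tsupport η
    · exact Or.inr ⟨(hM (Set.mem_image_of_mem p hx)).trans (le_max_left _ _),
        (hL x).trans (le_max_left _ _)⟩
    · exact Or.inl (gradient_eq_zero_of_notMem_tsupport hx)
  · rwa [← gradientModular_eq hΩ hu]
  · rw [← gradientModular_eq hΩ hu,
      ← gradientModular_eq hΩ (hu.add ((hasWeakGradient_of_test hη).const_smul t))]
    exact hmin _ (smul_mem_testFunctions t hη)

end WeakSolution

end VarExp

theorem theorem6p2 (n : ℕ) (hn : 1 ≤ n)
    (Ω : Set (EuclideanSpace ℝ (Fin n)))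
    (hΩ_open : IsOpen Ω) (hΩ_conn : IsConnected Ω) (hΩ_bdd : Bornology.IsBounded Ω)
    (hΩ_C2 : VarExp.HasC2Boundary Ω)
    (p : EuclideanSpace ℝ (Fin n) → ℝ) (hp_cont : ContinuousOn p Ω)
    (hp_inf : ∃ q : ℝ, (n : ℝ) < q ∧ ∀ x ∈ Ω, q ≤ p x)
    (φ : EuclideanSpace ℝ (Fin n) → ℝ) (hφ : φ ∈ VarExp.W1 Ω p)
    (hφ_grad : VarExp.gradientModular Ω p φ < ⊤) :
    ∃ u ∈ VarExp.W1 Ω p,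
      VarExp.IsWeakSolution Ω p u ∧ u - φ ∈ VarExp.V10 Ω p ∧
        ∃ v ∈ VarExp.V10 Ω p, u = φ - v ∧
          VarExp.gradientModular Ω p (v - φ) < ⊤ ∧
          ∀ w ∈ VarExp.V10 Ω p,
            VarExp.gradientModular Ω p (v - φ) ≤ VarExp.gradientModular Ω p (w - φ) := by
  obtain ⟨q, hnq, hq⟩ := hp_inf
  have hn1 : (1 : ℝ) ≤ n := by exact_mod_cast hn
  have : IsFiniteMeasure (volume.restrict Ω) :=
    isFiniteMeasure_restrict.2 hΩ_bdd.measure_lt_top.ne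
  have hpm : AEMeasurable p (volume.restrict Ω) := hp_cont.aemeasurable hΩ_open.measurableSet
  have hp : ∀ᵐ x ∂volume.restrict Ω, q ≤ p x :=
    ae_restrict_of_forall_mem hΩ_open.measurableSet hq
  have hρ : Modular.IsQuasiConvex (VarExp.sobolevModular Ω p) :=
    VarExp.isQuasiConvex_sobolevModular hΩ_open hpm (hp.mono fun x hx => by linarith)
  have hp1 : ∀ᵐ x ∂volume.restrict Ω, 1 ≤ p x := hp.mono fun x hx => by linarith
  have hneg : ∀ {w}, w ∈ VarExp.V10 Ω p → -w ∈ VarExp.V10 Ω p :=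
    VarExp.neg_mem_V10 hΩ_open hpm hp1
  -- The energy is even, so the minimizer of the energy of `w - φ` also minimizes that of `φ - w`.
  have heven : ∀ {w}, w ∈ VarExp.W1 Ω p →
      VarExp.gradientModular Ω p (-w) = VarExp.gradientModular Ω p w := fun {w} hw => by
    have hG := VarExp.hasWeakGradient_of_mem_W1 hw
    rw [← neg_one_smul ℝ w, VarExp.gradientModular_eq hΩ_open (hG.const_smul (-1)),
      VarExp.gradientModular_eq hΩ_open hG]
    simp [VarExp.normModular]
  obtain ⟨v, hv, hfin, hmin⟩ :=
    VarExp.exists_minimizer hn hΩ_open hΩ_bdd hpm hnq hp hφ hφ_grad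
  have hsub : ∀ {w}, w ∈ VarExp.V10 Ω p → φ - w ∈ VarExp.W1 Ω p := fun {w} hw => by
    rw [sub_eq_add_neg]
    exact Modular.add_mem_space hρ hφ (VarExp.V10_subset_W1 hΩ_open hp1 (hneg hw))
  have hE : ∀ {w}, w ∈ VarExp.V10 Ω p →
      VarExp.gradientModular Ω p (φ - w) = VarExp.gradientModular Ω p (w - φ) := fun hw => by
    rw [← heven (hsub hw), neg_sub]
  refine ⟨φ - v, hsub hv, ?_, ?_, v, hv, rfl, hfin, hmin⟩
  · refine VarExp.isWeakSolution_of_isMin hΩ_open hp_cont (fun x hx => by linarith [hq x hx])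
      (VarExp.hasWeakGradient_of_mem_W1 (hsub hv)) (by rwa [hE hv]) fun η hη => ?_
    have hvη : v + -η ∈ VarExp.V10 Ω p :=
      VarExp.add_mem_V10 hΩ_open hpm hp1 hv (hneg (Modular.subset_closure hη))
    have h1 : φ - v + η = φ - (v + -η) := by abel
    rw [h1, hE hv, hE hvη]
    exact hmin _ hvη
  · rw [sub_sub_cancel_left]
    exact hneg hv
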